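/- Let $H$ be a real separable Hilbert space, $W=\{W(h):h\in H\}$ an isonormal Gaussian process over $H$ on a probability space $(\Omega,\mathcal F,\mathbb P)$ (a centered Gaussian family with $\mathbb E(W(h)W(k))=\langle h,k\rangle_H$), and $n\ge 1$. For a symmetric tensor $u\in H^{\otimes n}$ let $I_n(u)$ be its multiple Wiener–Itô integral, i.e. the continuous linear extension to the symmetric tensors in $H^{\otimes n}$ of $I_n(e_{j_1}^{\hat\otimes k_1}\hat\otimes\cdots\hat\otimes e_{j_p}^{\hat\otimes k_p})=\prod_i H_{k_i}(W(e_{j_i}))$ ($k_1+\dots+k_p=n$, $j_1,\dots,j_p$ distinct, $(e_j)$ an orthonormal basis of $H$, $H_k$ the $k$-th Hermite polynomial with leading coefficient $1$). Let $(X_t)_{0\le t\le 1}$ be an almost surely continuous process with $X_t=I_n(f_t)$, where each $f_t\in H^{\otimes n}$ is symmetric. Write $X_{s,t}=X_t-X_s$ and $f_{s,t}=f_t-f_s$. Assume: (a) $f_0=0$, and there are $\theta>1$ and $C_0>0$ with $0<\|f_{s,t}\|_{H^{\otimes n}}\le C_0|t-s|^{\theta/2}$ for all $0\le s<t\le 1$;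 (b) there is $\beta\in(0,1)$ such that for all $m\ge1$, $k,l\ge0$, all $0=s_0<s_1<\dots<s_k=t_0<t_1<\dots<t_m=r_0<r_1<\dots<r_l\le 1$ (where $k=0$ means $t_0=0$) and all $(a_1,\dots,a_m)\in\mathbb R^m\setminus\{0\}$, the vector $v=\sum_{i=1}^m a_i f_{t_{i-1},t_i}$ satisfies $\|v-Pv\|^2>\beta\|v\|^2$, where $P$ is the orthogonal projection of $H^{\otimes n}$ onto the span of $f_{s_0,s_1},\dots,f_{s_{k-1},s_k},f_{r_0,r_1},\dots,f_{r_{l-1},r_l}$; (c) $\langle f_{u,v},f_{s,t}\rangle_{H^{\otimes n}}\ge0$ whenever $[u,v]\subset[s,t]\subset[0,1]$; (d) there are $\eta,C>0$ with $\mathbb E(X_{s,t}^2)\ge C|t-s|^\eta$ for all $0\le s<t\le1$. Let $g:[0,1]\to\mathbb R$ be $\tau$-Hölder continuous, $\tau>0$, where $\tau+\rho>1$ for some $\rho<\theta/2$, and let $\|g\|_\tau=\sup_{s\ne t}|g_t-g_s|/|t-s|^\tau$. Then almost surely the Young integral $\int_0^1 g_t\,dX_t$ (the limit of the tagged Riemann–Stieltjes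 sums as the mesh tends to $0$) exists, it is square integrable, and $$\sup_{r\in[0,1]}|g_r|\le\max\left\{\frac{2}{\sqrt\beta}\bigl(\mathbb E X_1^2\bigr)^{-\frac12}\left(\mathbb E\Bigl(\int_0^1 g_t\,dX_t\Bigr)^2\right)^{\frac12},\ \frac{2}{(\beta C)^{\frac{\tau}{2\tau+\eta}}}\left(\mathbb E\Bigl(\int_0^1 g_t\,dX_t\Bigr)^2\right)^{\frac{\tau}{2\tau+\eta}}\|g\|_\tau^{\frac{\eta}{2\tau+\eta}}\right\}.$$ -/

import Mathlib

open MeasureTheory ProbabilityTheory Filter Topology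
open scoped unitInterval NNReal ENNReal InnerProductSpace

/-- `W = {W h : h ∈ H}` is an isonormal Gaussian process over the real Hilbert space `H`: a centered
Gaussian family with covariance `E (W h * W k) = ⟪h, k⟫`. -/
structure IsIsonormal {Ω H : Type*} [MeasurableSpace Ω] [NormedAddCommGroup H]
    [InnerProductSpace ℝ H] (W : H → Ω → ℝ) (P : Measure Ω) : Prop where
  gaussian : IsGaussianProcess W P
  centered : ∀ h, ∫ ω, W h ω ∂P = 0
  covariance : ∀ h k, ∫ ω, W h ω * W k ω ∂P = ⟪h, k⟫_ℝ

/-- The Hilbert tensor power `H^{⊗n}`, in the coordinates given by an orthonormal basis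
`(e_i)_{i ∈ ι}` of `H`: the family `e_J = e_{J 0} ⊗ ⋯ ⊗ e_{J (n-1)}`, `J : Fin n → ι`, is an
orthonormal basis of `H^{⊗n}`, and `u : HilbertTensorPower ι n` stands for `∑_J u J • e_J`. -/
abbrev HilbertTensorPower (ι : Type*) (n : ℕ) : Type _ :=
  lp (fun _ : Fin n → ι => ℝ) 2

/-- `u` lies in the symmetric tensor power of `H`. -/
def IsSymmetricTensor {ι : Type*} {n : ℕ} (u : HilbertTensorPower ι n) : Prop :=
  ∀ (p : Equiv.Perm (Fin n)) (J : Fin n → ι), u (J ∘ p) = u J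

open Classical in
/-- The multiple Wiener-Itô integral of the symmetrization of `e_J`: it is
`∏_i H_{k_i} (W (e_i))`, where `k_i` is the number of occurrences of `i` in `J` and `H_k` is the
`k`-th (probabilists') Hermite polynomial. -/
noncomputable def basicMultipleIntegral {Ω H ι : Type*} [NormedAddCommGroup H]
    [InnerProductSpace ℝ H] (e : HilbertBasis ι ℝ H) (W : H → Ω → ℝ) {n : ℕ} (J : Fin n → ι)
    (ω : Ω) : ℝ :=
  ∏ i ∈ Finset.univ.image J,
    Polynomial.aeval (W (e i) ω) (Polynomial.hermite (Finset.univ.filter fun k => J k = i).card)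

/-- `Y = I_n(u)`: the tensor `u = ∑_J u J • e_J` is symmetric, and `Y` is the `L²(P)`-limit of the
multiple Wiener-Itô integrals `∑_{J ∈ F} u J • I_n(sym e_J)` of (the symmetrizations of) the finite
partial sums of `u`. -/
structure IsMultipleIntegral {Ω H ι : Type*} [MeasurableSpace Ω] [NormedAddCommGroup H]
    [InnerProductSpace ℝ H] (e : HilbertBasis ι ℝ H) (W : H → Ω → ℝ) (P : Measure Ω) {n : ℕ}
    (u : HilbertTensorPower ι n) (Y : Ω → ℝ) : Prop where
  symmetric : IsSymmetricTensor u
  memLp : MemLp Y 2 P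
  tendsto : Tendsto (fun F : Finset (Fin n → ι) =>
    eLpNorm (fun ω => (∑ J ∈ F, u J * basicMultipleIntegral e W J ω) - Y ω) 2 P) atTop (𝓝 0)

/-- The kernels start at `0`, and their increments are nonzero and are `θ / 2`-Hölder
continuous, for an exponent `θ > 1`. -/
structure KernelRegularity {E : Type*} [NormedAddCommGroup E] (f : I → E) (θ : ℝ) : Prop where
  one_lt : 1 < θ
  zero : f 0 = 0
  holder : ∃ C : ℝ, 0 < C ∧ ∀ s t : I, s < t →
    0 < ‖f t - f s‖ ∧ ‖f t - f s‖ ≤ C * ((t : ℝ) - s) ^ (θ / 2)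

/-- The increments of `f` along the finite sequence `t`. -/
def increments {E : Type*} [NormedAddCommGroup E] (f : I → E) {m : ℕ} (t : Fin (m + 1) → I)
    (i : Fin m) : E :=
  f (t i.succ) - f (t i.castSucc)

/-- Kernel-level nondeterminism with constant `β`. For every nonzero linear combination `v` of the
increments of `f` along `t_0 < ⋯ < t_m`, the distance from `v` to the closed span of the increments
of `f` along finitely many points `0 = s_0 < ⋯ < s_k = t_0` and `t_m = r_0 < ⋯ < r_l ≤ 1` has
square larger than `β ‖v‖²`. (So `k = 0` forces `t_0 = 0`; `l = 0` means no increment on the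
right.) -/
structure KernelNondeterminism {E : Type*} [NormedAddCommGroup E] [InnerProductSpace ℝ E]
    [CompleteSpace E] (f : I → E) (β : ℝ) : Prop where
  pos : 0 < β
  lt_one : β < 1
  projection : ∀ (m k l : ℕ) (t : Fin (m + 1) → I) (s : Fin (k + 1) → I) (r : Fin (l + 1) → I)
    (a : Fin m → ℝ), StrictMono t → StrictMono s → StrictMono r →
    s 0 = 0 → s (Fin.last k) = t 0 → r 0 = t (Fin.last m) → a ≠ 0 →
    ‖(∑ i, a i • increments f t i) -
        (Submodule.span ℝ (Set.range (increments f s) ∪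
          Set.range (increments f r))).topologicalClosure.starProjection
            (∑ i, a i • increments f t i)‖ ^ 2
      > β * ‖∑ i, a i • increments f t i‖ ^ 2

/-- `⟪f_v - f_u, f_t - f_s⟫ ≥ 0` whenever `[u, v] ⊆ [s, t] ⊆ [0, 1]`. -/
def NonnegRowSum {E : Type*} [NormedAddCommGroup E] [InnerProductSpace ℝ E] (f : I → E) : Prop :=
  ∀ s u v t : I, s ≤ u → u ≤ v → v ≤ t → 0 ≤ ⟪f v - f u, f t - f s⟫_ℝ

/-- `y` is the Young (Riemann-Stieltjes) integral `∫_0^1 g dx`: the limit of the sums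
`∑_i g (c_i) (x (t_{i+1}) - x (t_i))`, `t_i ≤ c_i ≤ t_{i+1}`, over tagged partitions
`0 = t_0 ≤ ⋯ ≤ t_N = 1` whose mesh tends to `0`. -/
def HasYoungIntegral (g x : I → ℝ) (y : ℝ) : Prop :=
  ∀ ε > 0, ∃ δ > 0, ∀ (N : ℕ) (t c : ℕ → I), t 0 = 0 → t N = 1 →
    (∀ i < N, t i ≤ c i ∧ c i ≤ t (i + 1) ∧ (t (i + 1) : ℝ) - t i < δ) →
    |(∑ i ∈ Finset.range N, g (c i) * (x (t (i + 1)) - x (t i))) - y| < ε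

/-- The Young integral is unique when it exists. -/
theorem HasYoungIntegral.unique {g x : I → ℝ} {y z : ℝ} (hy : HasYoungIntegral g x y)
    (hz : HasYoungIntegral g x z) : y = z := by
  by_contra hne
  have hpos : 0 < |y - z| / 2 := by
    have := abs_pos.2 (sub_ne_zero.2 hne)
    linarith
  obtain ⟨δ₁, h1, H1⟩ := hy _ hpos
  obtain ⟨δ₂, h2, H2⟩ := hz _ hpos
  obtain ⟨N, hN⟩ := exists_nat_one_div_lt (lt_min h1 h2)
  have hN0 : (0 : ℝ) < (N : ℝ) + 1 := by positivity
  let t : ℕ → I := fun i => Set.projIcc 0 1 zero_le_one ((i : ℝ) / ((N : ℝ) + 1))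
  have ht : ∀ i, i ≤ N + 1 → (t i : ℝ) = (i : ℝ) / ((N : ℝ) + 1) := by
    intro i hi
    have hi' : (i : ℝ) ≤ (N : ℝ) + 1 := by exact_mod_cast hi
    have hmem : (i : ℝ) / ((N : ℝ) + 1) ∈ Set.Icc (0 : ℝ) 1 :=
      ⟨by positivity, (div_le_one hN0).2 hi'⟩
    simp only [t, Set.projIcc_of_mem zero_le_one hmem]
  have ht0 : t 0 = 0 := Subtype.ext (by rw [ht 0 (by omega)]; simp)
  have ht1 : t (N + 1) = 1 := by
    refine Subtype.ext ?_
    rw [ht (N + 1) le_rfl]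
    push_cast
    exact div_self hN0.ne'
  have hstep : ∀ i < N + 1, (t (i + 1) : ℝ) - t i = 1 / ((N : ℝ) + 1) := by
    intro i hi
    rw [ht (i + 1) (by omega), ht i (by omega)]
    push_cast
    ring
  have hle : ∀ i < N + 1, t i ≤ t (i + 1) := by
    intro i hi
    have h3 := hstep i hi
    have h4 : (0 : ℝ) < 1 / ((N : ℝ) + 1) := by positivity
    exact Subtype.coe_le_coe.1 (by linarith)
  have A := H1 (N + 1) t t ht0 ht1 fun i hi =>
    ⟨le_rfl, hle i hi, by rw [hstep i hi]; exact hN.trans_le (min_le_left _ _)⟩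
  have B := H2 (N + 1) t t ht0 ht1 fun i hi =>
    ⟨le_rfl, hle i hi, by rw [hstep i hi]; exact hN.trans_le (min_le_right _ _)⟩
  rw [abs_lt] at A B
  rcases abs_cases (y - z) with h | h <;> linarith [h.1]

/-! The heart is a lower bound on the second moment. The Wiener–Itô isometry `E I_n(u)² = n! ‖u‖²`
turns `E (∫ g dX)²` into `n! ‖∫ g df‖²`, where `∫ g df` is the limit in `H^{⊗n}` of the dyadic sums
`dyadicSum g f N`. Suppose `g ≥ b > 0` on `[s, t]`. Split a dyadic sum into its part `v` inside `[s,
t]` and the parts to the left and right. Projecting onto the orthogonal complement of the outer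
increments kills the outer parts and, by nondeterminism, keeps more than the fraction `β` of `‖v‖²`.
Pairing `v` with `f_{s,t}` and using the nonnegative row sums gives `‖v‖ ≥ b ‖f_{s,t}‖`. In the
limit, `E (∫ g dX)² ≥ β b² E X_{s,t}²` (`KernelNondeterminism.norm_limit_sq_ge`).

Now take `b = M / 2` with `M = max |g|`. A Hölder function stays of one sign and at least `M / 2` in
size on all of `[0, 1]`, which yields the first term of the maximum, or on an interval of length `δ`
with `‖g‖_τ δ^τ = M / 2`. In the second case `E X_{s,t}² ≥ C δ^η`, and eliminating `δ` yields the
second term.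

Existence of the pathwise integral uses second moments only, without hypercontractivity. The
weighted sums of squared dyadic increments of a path form an almost surely finite superadditive
control `w`, with `|x_t - x_s| ≲ |t - s|^(ρ' - 1/2) w(s,t)^(1/2)` for some `1/2 < ρ' < θ/2`. The
missing half power is recovered by Cauchy–Schwarz over the intervals of a partition, so `τ + ρ' > 1`
suffices (`exists_hasYoungIntegral`). Fatou's lemma identifies the pathwise integral with the `L²`
limit (`memLp_and_tendsto_of_isometry`). -/

/-! ### Functions with moments of all orders -/

/-- Hölder's inequality with exponents `2q, 2q`: asking for all finite moments at once makes the
class stable under products, hence under polynomials. -/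
theorem memLp_mul_of_forall_ne_top {α : Type*} [MeasurableSpace α] {μ : Measure α} {f g : α → ℝ}
    (hf : ∀ q : ℝ≥0∞, q ≠ ∞ → MemLp f q μ) (hg : ∀ q : ℝ≥0∞, q ≠ ∞ → MemLp g q μ)
    (q : ℝ≥0∞) (hq : q ≠ ∞) : MemLp (fun x => f x * g x) q μ := by
  have h2 : 2 * q ≠ ∞ := ENNReal.mul_ne_top (by norm_num) hq
  have : ENNReal.HolderTriple (2 * q) (2 * q) q := ⟨by
    rw [ENNReal.mul_inv (by simp) (by simp), ← two_mul, ← mul_assoc,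
      ENNReal.mul_inv_cancel (by simp) (by simp), one_mul]⟩
  exact (hg _ h2).mul (hf _ h2)

theorem memLp_aeval_of_forall_ne_top {α : Type*} [MeasurableSpace α] {μ : Measure α}
    [IsFiniteMeasure μ] {Z : α → ℝ} (hZ : ∀ q : ℝ≥0∞, q ≠ ∞ → MemLp Z q μ) (p : Polynomial ℤ) :
    ∀ q : ℝ≥0∞, q ≠ ∞ → MemLp (fun x => Polynomial.aeval (Z x) p) q μ := by
  induction p using Polynomial.induction_on with
  | C a => intro q _; simpa using memLp_const (a : ℝ)
  | add p q hp hq => 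
    intro r hr
    simp only [map_add]
    exact (hp r hr).add (hq r hr)
  | monomial n a h =>
    intro q hq
    simpa [pow_succ, ← mul_assoc] using memLp_mul_of_forall_ne_top h hZ q hq

theorem memLp_prod_of_forall_ne_top {α κ : Type*} [MeasurableSpace α] {μ : Measure α}
    [IsFiniteMeasure μ] (s : Finset κ) {f : κ → α → ℝ}
    (hf : ∀ i ∈ s, ∀ q : ℝ≥0∞, q ≠ ∞ → MemLp (f i) q μ) :
    ∀ q : ℝ≥0∞, q ≠ ∞ → MemLp (fun x => ∏ i ∈ s, f i x) q μ := by
  induction s using Finset.cons_induction with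
  | empty => intro q _; simpa using memLp_const (1 : ℝ)
  | cons i s hi ih =>
    simp only [Finset.prod_cons]
    exact memLp_mul_of_forall_ne_top (hf i (by simp))
      (ih fun j hj => hf j (by simp [hj]))

/-! ### Hermite polynomials and the standard Gaussian measure -/

theorem memLp_aeval_gaussianReal (p : Polynomial ℤ) (q : ℝ≥0∞) (hq : q ≠ ∞) :
    MemLp (fun x : ℝ => Polynomial.aeval x p) q (gaussianReal 0 1) :=
  memLp_aeval_of_forall_ne_top (Z := fun x => x)
    (fun q hq => memLp_id_gaussianReal' q hq) p q hq

theorem integrable_aeval_gaussianReal (p : Polynomial ℤ) :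
    Integrable (fun x : ℝ => Polynomial.aeval x p) (gaussianReal 0 1) :=
  memLp_one_iff_integrable.1 (memLp_aeval_gaussianReal p 1 (by simp))

theorem integrable_gaussianPDFReal_mul_aeval (p : Polynomial ℤ) :
    Integrable (fun x : ℝ => gaussianPDFReal 0 1 x * Polynomial.aeval x p) := by
  have h := integrable_aeval_gaussianReal p
  rw [gaussianReal_of_var_ne_zero _ one_ne_zero,
    integrable_withDensity_iff_integrable_smul' (measurable_gaussianPDF _ _)
      (ae_of_all _ fun _ => gaussianPDF_lt_top)] at h
  simpa [toReal_gaussianPDF] using h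

theorem hasDerivAt_gaussianPDFReal_zero_one (x : ℝ) :
    HasDerivAt (gaussianPDFReal 0 1) (-(x * gaussianPDFReal 0 1 x)) x := by
  have h : HasDerivAt (fun y : ℝ => (√(2 * Real.pi * (1 : ℝ≥0)))⁻¹ *
      Real.exp (-(y - 0) ^ 2 / (2 * (1 : ℝ≥0))))
      ((√(2 * Real.pi * (1 : ℝ≥0)))⁻¹ * (Real.exp (-(x - 0) ^ 2 / (2 * (1 : ℝ≥0))) *
        (-((2 : ℕ) * (x - 0) ^ (2 - 1) * 1) / (2 * (1 : ℝ≥0))))) x :=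
    ((((((hasDerivAt_id x).sub_const 0).pow 2).neg).div_const _).exp).const_mul _
  rw [gaussianPDFReal_def]
  convert h using 1
  simp
  ring

/-- Gaussian integration by parts. -/
theorem integral_mul_aeval_gaussianReal (p : Polynomial ℤ) :
    ∫ x, x * Polynomial.aeval x p ∂(gaussianReal 0 1) =
      ∫ x, Polynomial.aeval x (Polynomial.derivative p) ∂(gaussianReal 0 1) := by
  rw [integral_gaussianReal_eq_integral_smul one_ne_zero,
    integral_gaussianReal_eq_integral_smul one_ne_zero]
  have h := integral_mul_deriv_eq_deriv_mul_of_integrable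
    (u := fun x : ℝ => Polynomial.aeval x p)
    (u' := fun x => Polynomial.aeval x (Polynomial.derivative p))
    (v := gaussianPDFReal 0 1) (v' := fun x => -(x * gaussianPDFReal 0 1 x))
    (fun x _ => p.hasDerivAt_aeval x) (fun x _ => hasDerivAt_gaussianPDFReal_zero_one x)
    (by
      refine (integrable_gaussianPDFReal_mul_aeval (Polynomial.X * p)).neg.congr
        (ae_of_all _ fun x => ?_)
      simp
      ring)
    ((integrable_gaussianPDFReal_mul_aeval (Polynomial.derivative p)).congr
      (ae_of_all _ fun x => mul_comm _ _))
    ((integrable_gaussianPDFReal_mul_aeval p).congr (ae_of_all _ fun x => mul_comm _ _))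
  simp only [mul_neg, integral_neg, neg_inj] at h
  simp only [smul_eq_mul]
  calc
    _ = ∫ x, Polynomial.aeval x p * (x * gaussianPDFReal 0 1 x) := by
      congr 1 with x
      ring
    _ = _ := h
    _ = _ := by
      congr 1 with x
      ring

theorem derivative_hermite_succ (n : ℕ) :
    Polynomial.derivative (Polynomial.hermite (n + 1)) =
      ((n : Polynomial ℤ) + 1) * Polynomial.hermite n := by
  induction n with
  | zero => simp
  | succ n ih =>
    rw [Polynomial.hermite_succ (n + 1), Polynomial.derivative_sub, Polynomial.derivative_mul, ih,
      Polynomial.derivative_mul]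
    have : Polynomial.derivative ((n : Polynomial ℤ) + 1) = 0 := by simp
    rw [this, Polynomial.hermite_succ n]
    simp
    ring

/-- `H_{j+1} = x H_j - H_j'`, so Gaussian integration by parts moves one degree of the Hermite
factor onto a derivative of `p`. -/
theorem integral_hermite_succ_mul (j : ℕ) (p : Polynomial ℤ) :
    ∫ x, Polynomial.aeval x (Polynomial.hermite (j + 1) * p) ∂(gaussianReal 0 1) =
      ∫ x, Polynomial.aeval x (Polynomial.hermite j * Polynomial.derivative p)
        ∂(gaussianReal 0 1) := by
  have h := integral_mul_aeval_gaussianReal (Polynomial.hermite j * p)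
  have h1 : ∀ x : ℝ, Polynomial.aeval x (Polynomial.hermite (j + 1) * p) =
      x * Polynomial.aeval x (Polynomial.hermite j * p) -
        Polynomial.aeval x (Polynomial.derivative (Polynomial.hermite j) * p) := by
    intro x
    simp [Polynomial.hermite_succ]
    ring
  simp only [h1]
  rw [integral_sub, h, ← integral_sub (integrable_aeval_gaussianReal _)
    (integrable_aeval_gaussianReal _)]
  · congr 1 with x
    simp
  · exact (integrable_aeval_gaussianReal (Polynomial.X * (Polynomial.hermite j * p))).congr
      (ae_of_all _ fun x => by simp)
  · exact integrable_aeval_gaussianReal _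

/-- The Hermite polynomials are orthogonal for the standard Gaussian measure. -/
theorem integral_hermite_mul_hermite (j k : ℕ) :
    ∫ x, Polynomial.aeval x (Polynomial.hermite j) * Polynomial.aeval x (Polynomial.hermite k)
      ∂(gaussianReal 0 1) = if j = k then (j.factorial : ℝ) else 0 := by
  induction j generalizing k with
  | zero =>
    cases k with
    | zero => simp
    | succ k =>
      have h := integral_hermite_succ_mul k 1
      simp only [mul_one, Polynomial.derivative_one, mul_zero, map_zero, integral_zero] at h
      simpa only [Polynomial.hermite_zero, map_one, one_mul, (Nat.succ_ne_zero k).symm,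
        if_false] using h
  | succ j ih =>
    have h := integral_hermite_succ_mul j (Polynomial.hermite k)
    simp only [map_mul] at h
    rw [h]
    cases k with
    | zero => simp
    | succ k =>
      have h2 : ∀ x : ℝ, Polynomial.aeval x (Polynomial.hermite j) *
          Polynomial.aeval x (Polynomial.derivative (Polynomial.hermite (k + 1))) =
          ((k : ℝ) + 1) * (Polynomial.aeval x (Polynomial.hermite j) *
            Polynomial.aeval x (Polynomial.hermite k)) := by
        intro x
        rw [derivative_hermite_succ]
        simp
        ring
      simp only [h2, integral_const_mul, ih]
      by_cases hjk : j = k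
      · simp [hjk, Nat.factorial_succ]
      · simp [hjk]

/-! ### Square integrals and convergence in mean square -/

theorem norm_toLp_sq {α : Type*} [MeasurableSpace α] {μ : Measure α} {f : α → ℝ}
    (hf : MemLp f 2 μ) : ‖hf.toLp f‖ ^ 2 = ∫ x, f x ^ 2 ∂μ := by
  rw [← real_inner_self_eq_norm_sq, L2.inner_def]
  refine integral_congr_ae ?_
  filter_upwards [hf.coeFn_toLp] with x hx
  simp [hx, sq]

theorem tendsto_integral_sq {α κ : Type*} [MeasurableSpace α] {μ : Measure α} {l : Filter κ}
    {Z : κ → α → ℝ} {Y : α → ℝ} (hZ : ∀ k, MemLp (Z k) 2 μ) (hY : MemLp Y 2 μ)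
    (h : Tendsto (fun k => eLpNorm (fun x => Z k x - Y x) 2 μ) l (𝓝 0)) :
    Tendsto (fun k => ∫ x, Z k x ^ 2 ∂μ) l (𝓝 (∫ x, Y x ^ 2 ∂μ)) := by
  have h1 : Tendsto (fun k => (hZ k).toLp (Z k)) l (𝓝 (hY.toLp Y)) :=
    (Lp.tendsto_Lp_iff_tendsto_eLpNorm'' Z hZ Y hY).2 h
  simpa only [norm_toLp_sq] using h1.norm.pow 2

theorem eLpNorm_two_eq_sqrt {α : Type*} [MeasurableSpace α] {μ : Measure α} {f : α → ℝ}
    (hf : MemLp f 2 μ) : eLpNorm f 2 μ = ENNReal.ofReal √(∫ x, f x ^ 2 ∂μ) := by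
  rw [← norm_toLp_sq hf, Real.sqrt_sq (norm_nonneg _), Lp.norm_toLp,
    ENNReal.ofReal_toReal hf.eLpNorm_ne_top]

/-! ### The isonormal process along an orthonormal basis -/

open Classical in
theorem basicMultipleIntegral_eq_prod {Ω H ι : Type*} [NormedAddCommGroup H]
    [InnerProductSpace ℝ H] {e : HilbertBasis ι ℝ H} {W : H → Ω → ℝ} {n : ℕ} (J : Fin n → ι) {S : Finset ι}
    (hS : Finset.univ.image J ⊆ S) (ω : Ω) :
    basicMultipleIntegral e W J ω = ∏ i ∈ S, Polynomial.aeval (W (e i) ω)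
      (Polynomial.hermite (Finset.univ.filter fun k => J k = i).card) := by
  refine Finset.prod_subset hS fun i _ hi => ?_
  have : (Finset.univ.filter fun k => J k = i) = ∅ := by
    ext k
    simp only [Finset.mem_image, Finset.mem_univ, true_and, not_exists] at hi
    simp [hi k]
  simp [this]

section Isonormal

variable {Ω H ι : Type*} [MeasurableSpace Ω] [NormedAddCommGroup H] [InnerProductSpace ℝ H]
  {P : Measure Ω} {e : HilbertBasis ι ℝ H} {W : H → Ω → ℝ}

theorem IsIsonormal.map_eq (hW : IsIsonormal W P) (i : ι) :
    P.map (W (e i)) = gaussianReal 0 1 := by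
  have := hW.gaussian.isProbabilityMeasure
  rw [(hW.gaussian.hasGaussianLaw_eval (e i)).map_eq_gaussianReal, hW.centered,
    variance_of_integral_eq_zero (hW.gaussian.aemeasurable _) (hW.centered _)]
  have : ∫ ω, W (e i) ω ^ 2 ∂P = 1 := by
    simp only [sq, hW.covariance]
    rw [real_inner_self_eq_norm_sq, e.orthonormal.1 i, one_pow]
  simp [this]

theorem IsIsonormal.iIndepFun (hW : IsIsonormal W P) : iIndepFun (fun i => W (e i)) P := by
  have := hW.gaussian.isProbabilityMeasure
  have h := IsGaussianProcess.iIndepFun_of_covariance_eq_zero (P := P)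
    (S := fun _ : ι => Unit) (X := fun i _ => W (e i))
    (hW.gaussian.comp_right fun p : (_ : ι) × Unit => e p.1)
    (fun i _ => hW.gaussian.aemeasurable _) (by
      intro i j hij _ _
      rw [covariance_eq_sub (hW.gaussian.hasGaussianLaw_eval _).memLp_two
        (hW.gaussian.hasGaussianLaw_eval _).memLp_two, hW.centered, hW.centered]
      simpa [hW.covariance] using e.orthonormal.2 hij)
  exact h.comp (fun _ x => x ()) fun _ => measurable_pi_apply ()

theorem IsIsonormal.memLp (hW : IsIsonormal W P) (h : H) (q : ℝ≥0∞) (hq : q ≠ ∞) :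
    MemLp (W h) q P :=
  (hW.gaussian.hasGaussianLaw_eval h).memLp hq

theorem IsIsonormal.memLp_basicMultipleIntegral (hW : IsIsonormal W P) {n : ℕ} (J : Fin n → ι)
    (q : ℝ≥0∞) (hq : q ≠ ∞) : MemLp (basicMultipleIntegral e W J) q P := by
  have := hW.gaussian.isProbabilityMeasure
  exact memLp_prod_of_forall_ne_top _
    (fun i _ => memLp_aeval_of_forall_ne_top (hW.memLp (e i)) _) q hq

open Classical in
-- The coordinates `W (e i)` are independent standard Gaussians, so the expectation factors over the
-- indices and Hermite orthogonality evaluates each factor. The outcome is `∏ i, c_i!` if `J` and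
-- `K` have the same occupation numbers `c_i`, and `0` otherwise.
theorem integral_basicMultipleIntegral_mul (hW : IsIsonormal W P) {n : ℕ} (J K : Fin n → ι) :
    ∫ ω, basicMultipleIntegral e W J ω * basicMultipleIntegral e W K ω ∂P =
      (Finset.univ.filter fun p : Equiv.Perm (Fin n) => J ∘ p = K).card := by
  have := hW.gaussian.isProbabilityMeasure
  set S := Finset.univ.image J ∪ Finset.univ.image K
  set c : (Fin n → ι) → ι → ℕ := fun L i => (Finset.univ.filter fun k => L k = i).card with hc
  have hprod : ∫ ω, basicMultipleIntegral e W J ω * basicMultipleIntegral e W K ω ∂P =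
      ∏ i ∈ S, if c J i = c K i then ((c J i).factorial : ℝ) else 0 := by
    simp only [basicMultipleIntegral_eq_prod J (S := S) Finset.subset_union_left,
      basicMultipleIntegral_eq_prod K (S := S) Finset.subset_union_right,
      ← Finset.prod_mul_distrib]
    have h := (hW.iIndepFun (e := e)).precomp (g := ((↑) : S → ι)) Subtype.val_injective
    have h2 := h.integral_fun_prod_comp (X := fun i : S => W (e i))
      (fun i => hW.gaussian.aemeasurable _)
      (f := fun i x => Polynomial.aeval x (Polynomial.hermite (c J i)) *
        Polynomial.aeval x (Polynomial.hermite (c K i)))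
      (fun i => by fun_prop)
    rw [← Finset.prod_coe_sort]
    simp only [← Finset.prod_coe_sort S]
    refine h2.trans (Finset.prod_congr rfl fun i _ => ?_)
    rw [← integral_hermite_mul_hermite, ← hW.map_eq (i := (i : ι)) (e := e),
      integral_map (hW.gaussian.aemeasurable _) (by fun_prop)]
  rw [hprod]
  -- If `K` is a rearrangement of `J`, the permutations carrying `J` to `K` are as many as the
  -- stabilizer of `J`, namely `∏ i, c_i!`. If not, some occupation number differs and both sides
  -- vanish.
  by_cases hJK : ∃ p : Equiv.Perm (Fin n), J ∘ p = K
  · obtain ⟨p, rfl⟩ := hJK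
    have hcc : ∀ i, c (J ∘ p) i = c J i := by
      intro i
      simp only [hc]
      exact Finset.card_equiv p (by simp)
    have himg : Finset.univ.image (J ∘ p) = Finset.univ.image J := by
      ext i
      simp only [Finset.mem_image, Finset.mem_univ, true_and, Function.comp_apply]
      exact p.surjective.exists (p := fun a => J a = i) |>.symm
    have h1 : (Finset.univ.filter fun q : Equiv.Perm (Fin n) => J ∘ q = J ∘ p).card =
        (Finset.univ.filter fun q : Equiv.Perm (Fin n) => J ∘ q = J).card := by
      refine Finset.card_equiv (Equiv.mulRight p⁻¹) fun q => ?_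
      simp only [Finset.mem_filter, Finset.mem_univ, true_and, Equiv.coe_mulRight,
        Equiv.Perm.coe_mul, ← Function.comp_assoc]
      constructor
      · intro h
        rw [h, Function.comp_assoc, ← Equiv.Perm.coe_mul]
        simp
      · intro h
        conv_rhs => rw [← h]
        rw [Function.comp_assoc, ← Equiv.Perm.coe_mul]
        simp
    rw [h1, ← Fintype.card_subtype, DomMulAct.stabilizer_card']
    simp only [S, himg, Finset.union_self, hcc, if_true, Nat.cast_prod]
    refine Finset.prod_congr rfl fun i _ => ?_
    rw [Fintype.card_subtype]
  · rw [(Finset.filter_eq_empty_iff (s := Finset.univ)).2 fun p _ h => hJK ⟨p, h⟩]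
    by_cases hcc : ∀ i, c J i = c K i
    · refine absurd ⟨Equiv.ofFiberEquiv (f := K) (g := J) fun i => Fintype.equivOfCardEq ?_, ?_⟩ hJK
      · rw [Fintype.card_subtype, Fintype.card_subtype]
        exact (hcc i).symm
      · ext1 a
        exact Equiv.ofFiberEquiv_map _ a
    · push Not at hcc
      obtain ⟨i, hi⟩ := hcc
      have hiS : i ∈ S := by
        by_contra h
        simp only [S, Finset.mem_union, Finset.mem_image, Finset.mem_univ, true_and, not_or,
          not_exists] at h
        exact hi (by simp [hc, h.1, h.2])
      simpa using Finset.prod_eq_zero hiS (if_neg hi)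

/-- For fixed `J`, the covariances sum to `∑ p, u J * u (J ∘ p)` over permutations `p`, which is `n!
u_J²` by symmetry. Closedness of `F` ensures that no `J ∘ p` is missed. -/
theorem integral_sum_basicMultipleIntegral_sq (hW : IsIsonormal W P) {n : ℕ}
    {u : (Fin n → ι) → ℝ} (hu : ∀ (p : Equiv.Perm (Fin n)) (J : Fin n → ι), u (J ∘ p) = u J)
    {F : Finset (Fin n → ι)} (hF : ∀ p : Equiv.Perm (Fin n), ∀ J ∈ F, J ∘ p ∈ F) :
    ∫ ω, (∑ J ∈ F, u J * basicMultipleIntegral e W J ω) ^ 2 ∂P =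
      n.factorial * ∑ J ∈ F, u J ^ 2 := by
  classical
  have hint : ∀ J K : Fin n → ι, Integrable (fun ω => u J * u K *
      (basicMultipleIntegral e W J ω * basicMultipleIntegral e W K ω)) P := fun J K =>
    (memLp_one_iff_integrable.1 (memLp_mul_of_forall_ne_top (hW.memLp_basicMultipleIntegral J)
      (hW.memLp_basicMultipleIntegral K) 1 (by simp))).const_mul _
  have h1 : ∀ ω, (∑ J ∈ F, u J * basicMultipleIntegral e W J ω) ^ 2 = ∑ J ∈ F, ∑ K ∈ F,
      u J * u K * (basicMultipleIntegral e W J ω * basicMultipleIntegral e W K ω) := by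
    intro ω
    rw [sq, Finset.sum_mul_sum]
    exact Finset.sum_congr rfl fun J _ => Finset.sum_congr rfl fun K _ => by ring
  simp only [h1]
  rw [integral_finsetSum _ fun J _ => integrable_finsetSum _ fun K _ => hint J K, Finset.mul_sum]
  refine Finset.sum_congr rfl fun J hJ => ?_
  rw [integral_finsetSum _ fun K _ => hint J K]
  simp only [integral_const_mul, integral_basicMultipleIntegral_mul hW, Finset.card_filter,
    Nat.cast_sum, Nat.cast_ite, Nat.cast_one, Nat.cast_zero, Finset.mul_sum]
  rw [Finset.sum_comm]
  have h2 : ∀ p : Equiv.Perm (Fin n),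
      (∑ K ∈ F, u J * u K * if J ∘ p = K then (1 : ℝ) else 0) = u J ^ 2 := by
    intro p
    rw [Finset.sum_eq_single_of_mem _ (hF p J hJ) fun K _ hK => by simp [hK.symm]]
    simp [hu, sq]
  rw [Finset.sum_congr rfl fun p _ => h2 p]
  simp [Fintype.card_perm]

/-- The Wiener–Itô isometry. Partial sums over arbitrary finite sets are not symmetric, so the limit
is taken along the permutation-closed sets `sym F`, which are cofinal. -/
theorem IsMultipleIntegral.integral_sq (hW : IsIsonormal W P) {n : ℕ}
    {u : HilbertTensorPower ι n} {Y : Ω → ℝ} (h : IsMultipleIntegral e W P u Y) :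
    ∫ ω, Y ω ^ 2 ∂P = n.factorial * ‖u‖ ^ 2 := by
  classical
  let sym : Finset (Fin n → ι) → Finset (Fin n → ι) := fun F =>
    (F ×ˢ (Finset.univ : Finset (Equiv.Perm (Fin n)))).image fun q => q.1 ∘ q.2
  have hsub : ∀ F, F ≤ sym F := fun F J hJ =>
    Finset.mem_image.2 ⟨(J, 1), by simpa using hJ, by simp⟩
  have hclosed : ∀ F, ∀ p : Equiv.Perm (Fin n), ∀ J ∈ sym F, J ∘ p ∈ sym F := by
    intro F p J hJ
    obtain ⟨⟨K, q⟩, hK, rfl⟩ := Finset.mem_image.1 hJ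
    exact Finset.mem_image.2 ⟨(K, q * p), by simpa using hK, by simp [Function.comp_assoc]⟩
  have hsym : Tendsto sym atTop atTop := tendsto_atTop_mono hsub tendsto_id
  have h1 := tendsto_integral_sq (fun F => memLp_finsetSum _ fun J _ =>
    (hW.memLp_basicMultipleIntegral J 2 (by simp)).const_mul _) h.memLp (h.tendsto.comp hsym)
  simp only [integral_sum_basicMultipleIntegral_sq hW h.symmetric (hclosed _)] at h1
  have h2 : HasSum (fun J => u J ^ 2) (‖u‖ ^ 2) := by
    have h3 := lp.hasSum_norm (p := 2) (by simp) u
    simpa using h3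
  exact tendsto_nhds_unique h1 ((h2.comp hsym).const_mul _)

theorem IsMultipleIntegral.sum {κ : Type*} (s : Finset κ) (hW : IsIsonormal W P) {n : ℕ}
    {u : κ → HilbertTensorPower ι n} {Y : κ → Ω → ℝ}
    (h : ∀ i ∈ s, IsMultipleIntegral e W P (u i) (Y i)) (a : κ → ℝ) :
    IsMultipleIntegral e W P (∑ i ∈ s, a i • u i) (fun ω => ∑ i ∈ s, a i * Y i ω) where
  symmetric p J := by
    simp only [lp.coeFn_sum, Finset.sum_apply, lp.coeFn_smul, Pi.smul_apply]
    exact Finset.sum_congr rfl fun i hi => by rw [(h i hi).symmetric p J]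
  memLp := memLp_finsetSum _ fun i hi => (h i hi).memLp.const_mul _
  tendsto := by
    have hlim : Tendsto (fun F : Finset (Fin n → ι) => ∑ i ∈ s, ‖a i‖ₑ *
        eLpNorm (fun ω => (∑ J ∈ F, u i J * basicMultipleIntegral e W J ω) - Y i ω) 2 P)
        atTop (𝓝 0) := by
      have := tendsto_finsetSum s fun i hi =>
        ENNReal.Tendsto.const_mul (a := ‖a i‖ₑ) (h i hi).tendsto (Or.inr (by simp))
      simpa using this
    refine tendsto_of_tendsto_of_tendsto_of_le_of_le tendsto_const_nhds hlim
      (fun _ => zero_le) fun F => ?_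
    have heq : (fun ω => (∑ J ∈ F, (∑ i ∈ s, a i • u i : HilbertTensorPower ι n) J *
        basicMultipleIntegral e W J ω) - ∑ i ∈ s, a i * Y i ω) = ∑ i ∈ s, a i •
        fun ω => (∑ J ∈ F, u i J * basicMultipleIntegral e W J ω) - Y i ω := by
      ext ω
      simp only [lp.coeFn_sum, Finset.sum_apply, lp.coeFn_smul, Pi.smul_apply, smul_eq_mul,
        mul_sub, Finset.sum_sub_distrib, Finset.mul_sum, Finset.sum_mul]
      rw [Finset.sum_comm]
      simp only [mul_assoc]
    simp only [heq]
    refine (eLpNorm_sum_le (fun i hi => ?_) (by norm_num)).trans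
      (Finset.sum_le_sum fun i _ => (eLpNorm_const_smul _ _ _ _).le)
    exact (((memLp_finsetSum _ fun J _ =>
      (hW.memLp_basicMultipleIntegral J 2 (by simp)).const_mul _).sub
        (h i hi).memLp).const_smul _).aestronglyMeasurable

end Isonormal

/-! ### The dyadic control of a path -/

/-- The sum of the squared increments of `x` over the dyadic intervals of level `n` in `[s, t]`. -/
noncomputable def dyadicEnergy (x : ℝ → ℝ) (n : ℕ) (s t : ℝ) : ℝ :=
  ∑ k ∈ Finset.range (2 ^ n), if s ≤ (k : ℝ) / 2 ^ n ∧ ((k : ℝ) + 1) / 2 ^ n ≤ t then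
    (x (((k : ℝ) + 1) / 2 ^ n) - x ((k : ℝ) / 2 ^ n)) ^ 2 else 0

/-- The superadditive function `∑ n, r ^ (-2 n) * dyadicEnergy x n s t`. -/
noncomputable def dyadicControl (x : ℝ → ℝ) (r s t : ℝ) : ℝ :=
  ∑' n, dyadicEnergy x n s t / (r ^ n) ^ 2

theorem dyadicEnergy_nonneg (x : ℝ → ℝ) (n : ℕ) (s t : ℝ) : 0 ≤ dyadicEnergy x n s t :=
  Finset.sum_nonneg fun k _ => by split_ifs <;> positivity

theorem dyadicEnergy_mono (x : ℝ → ℝ) (n : ℕ) {s t s' t' : ℝ} (hs : s' ≤ s) (ht : t ≤ t') :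
    dyadicEnergy x n s t ≤ dyadicEnergy x n s' t' := by
  refine Finset.sum_le_sum fun k _ => ?_
  by_cases h : s ≤ (k : ℝ) / 2 ^ n ∧ ((k : ℝ) + 1) / 2 ^ n ≤ t
  · rw [if_pos h, if_pos ⟨hs.trans h.1, h.2.trans ht⟩]
  · rw [if_neg h]
    split_ifs <;> positivity

/-- A dyadic interval lies in at most one of `[s, u]` and `[u, t]`; those straddling `u` count only
on the right-hand side. -/
theorem dyadicEnergy_add_le (x : ℝ → ℝ) (n : ℕ) {s u t : ℝ} (hsu : s ≤ u) (hut : u ≤ t) :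
    dyadicEnergy x n s u + dyadicEnergy x n u t ≤ dyadicEnergy x n s t := by
  unfold dyadicEnergy
  rw [← Finset.sum_add_distrib]
  refine Finset.sum_le_sum fun k _ => ?_
  have hk : (k : ℝ) / 2 ^ n < ((k : ℝ) + 1) / 2 ^ n := by gcongr; linarith
  by_cases h1 : s ≤ (k : ℝ) / 2 ^ n ∧ ((k : ℝ) + 1) / 2 ^ n ≤ u
  · have h2 : ¬(u ≤ (k : ℝ) / 2 ^ n ∧ ((k : ℝ) + 1) / 2 ^ n ≤ t) := fun h => by
      linarith [h.1, h1.2]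
    rw [if_pos h1, if_neg h2, if_pos ⟨h1.1, h1.2.trans hut⟩, add_zero]
  · rw [if_neg h1, zero_add]
    by_cases h2 : u ≤ (k : ℝ) / 2 ^ n ∧ ((k : ℝ) + 1) / 2 ^ n ≤ t
    · rw [if_pos h2, if_pos ⟨hsu.trans h2.1, h2.2⟩]
    · rw [if_neg h2]
      split_ifs <;> positivity

section Control

variable {x : ℝ → ℝ} {r : ℝ}

theorem dyadicControl_nonneg (x : ℝ → ℝ) (r s t : ℝ) : 0 ≤ dyadicControl x r s t :=
  tsum_nonneg fun n => div_nonneg (dyadicEnergy_nonneg _ _ _ _) (by positivity)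

theorem summable_dyadicEnergy (hx : Summable fun n => dyadicEnergy x n 0 1 / (r ^ n) ^ 2)
    {s t : ℝ} (hs : 0 ≤ s) (ht : t ≤ 1) : Summable fun n => dyadicEnergy x n s t / (r ^ n) ^ 2 :=
  hx.of_nonneg_of_le (fun n => div_nonneg (dyadicEnergy_nonneg _ _ _ _) (by positivity))
    fun n => by
      gcongr
      exact dyadicEnergy_mono x n hs ht

theorem dyadicControl_mono (hx : Summable fun n => dyadicEnergy x n 0 1 / (r ^ n) ^ 2)
    {s t s' t' : ℝ} (hs' : 0 ≤ s') (hs : s' ≤ s) (ht : t ≤ t') (ht' : t' ≤ 1) :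
    dyadicControl x r s t ≤ dyadicControl x r s' t' :=
  (summable_dyadicEnergy hx (hs'.trans hs) (ht.trans ht')).tsum_le_tsum
    (fun n => by gcongr; exact dyadicEnergy_mono x n hs ht) (summable_dyadicEnergy hx hs' ht')

theorem dyadicControl_add_le (hx : Summable fun n => dyadicEnergy x n 0 1 / (r ^ n) ^ 2)
    {s u t : ℝ} (hs : 0 ≤ s) (hsu : s ≤ u) (hut : u ≤ t) (ht : t ≤ 1) :
    dyadicControl x r s u + dyadicControl x r u t ≤ dyadicControl x r s t := by
  have h1 := summable_dyadicEnergy hx hs (hut.trans ht)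
  have h2 := summable_dyadicEnergy hx (hs.trans hsu) ht
  unfold dyadicControl
  rw [← h1.tsum_add h2]
  refine (h1.add h2).tsum_le_tsum (fun n => ?_) (summable_dyadicEnergy hx hs ht)
  rw [← add_div]
  gcongr
  exact dyadicEnergy_add_le x n hsu hut

theorem sum_dyadicControl_le (hx : Summable fun n => dyadicEnergy x n 0 1 / (r ^ n) ^ 2)
    {N : ℕ} {t : ℕ → ℝ} (h0 : 0 ≤ t 0) (ht : ∀ i < N, t i ≤ t (i + 1)) (h1 : t N ≤ 1) :
    ∑ i ∈ Finset.range N, dyadicControl x r (t i) (t (i + 1)) ≤ dyadicControl x r (t 0) (t N) := by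
  have hmono : ∀ i ≤ N, t 0 ≤ t i := by
    intro i hi
    induction i with
    | zero => rfl
    | succ i ih => exact (ih (by omega)).trans (ht i (by omega))
  induction N with
  | zero => simpa using dyadicControl_nonneg x r (t 0) (t 0)
  | succ N ih =>
    rw [Finset.sum_range_succ]
    have h2 := ht N (by omega)
    exact (add_le_add_left (ih (fun i hi => ht i (by omega)) (h2.trans h1)
      fun i hi => hmono i (by omega)) _).trans
      (dyadicControl_add_le hx h0 (hmono N (by omega)) h2 h1)

theorem abs_dyadic_increment_le (hx : Summable fun n => dyadicEnergy x n 0 1 / (r ^ n) ^ 2)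
    (hr : 0 < r) {s t : ℝ} (hs : 0 ≤ s) (ht : t ≤ 1) {n k : ℕ} (hsk : s ≤ (k : ℝ) / 2 ^ n)
    (hkt : ((k : ℝ) + 1) / 2 ^ n ≤ t) :
    |x (((k : ℝ) + 1) / 2 ^ n) - x ((k : ℝ) / 2 ^ n)| ≤ r ^ n * √(dyadicControl x r s t) := by
  have hk : k < 2 ^ n := by
    have : ((k : ℝ) + 1) ≤ 2 ^ n := by
      have := hkt.trans ht
      rwa [div_le_one (by positivity)] at this
    exact_mod_cast this
  have h1 : (x (((k : ℝ) + 1) / 2 ^ n) - x ((k : ℝ) / 2 ^ n)) ^ 2 ≤ dyadicEnergy x n s t := by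
    have := Finset.single_le_sum (f := fun k : ℕ => if s ≤ (k : ℝ) / 2 ^ n ∧
      ((k : ℝ) + 1) / 2 ^ n ≤ t then (x (((k : ℝ) + 1) / 2 ^ n) - x ((k : ℝ) / 2 ^ n)) ^ 2 else 0)
      (fun k _ => by split_ifs <;> positivity) (Finset.mem_range.2 hk)
    rwa [if_pos (And.intro hsk hkt)] at this
  have h2 : dyadicEnergy x n s t / (r ^ n) ^ 2 ≤ dyadicControl x r s t :=
    (summable_dyadicEnergy hx hs ht).le_tsum n fun m _ =>
      div_nonneg (dyadicEnergy_nonneg _ _ _ _) (by positivity)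
  rw [div_le_iff₀ (by positivity)] at h2
  refine abs_le_of_sq_le_sq (h1.trans (h2.trans ?_)) (by positivity)
  rw [mul_pow, Real.sq_sqrt (dyadicControl_nonneg _ _ _ _), mul_comm]

/-- Refining by one level either fixes the lower dyadic approximation of `t` or moves it across one
interval of level `n + 1`, still inside `[s, t]`. -/
theorem abs_dyadic_refine_floor_le (hx : Summable fun n => dyadicEnergy x n 0 1 / (r ^ n) ^ 2)
    (hr : 0 < r) (hr1 : r < 1) {s t : ℝ} (hs : 0 ≤ s) (hst : s ≤ t) (ht : t ≤ 1) {n : ℕ}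
    (hn : s ≤ (⌊t * 2 ^ n⌋₊ : ℝ) / 2 ^ n) :
    |x ((⌊t * 2 ^ n⌋₊ : ℝ) / 2 ^ n) - x ((⌊t * 2 ^ (n + 1)⌋₊ : ℝ) / 2 ^ (n + 1))| ≤
      √(dyadicControl x r s t) * r ^ n := by
  have ht0 : 0 ≤ t := hs.trans hst
  set a := ⌊t * 2 ^ n⌋₊
  set b := ⌊t * 2 ^ (n + 1)⌋₊ with hb
  have hp : (2 : ℝ) ^ (n + 1) = 2 * 2 ^ n := by ring
  have ha1 : (a : ℝ) ≤ t * 2 ^ n := Nat.floor_le (by positivity)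
  have ha2 : t * 2 ^ n < a + 1 := Nat.lt_floor_add_one _
  have hb1 : (b : ℝ) ≤ t * 2 ^ (n + 1) := Nat.floor_le (by positivity)
  have h1 : 2 * a ≤ b := Nat.le_floor (by push_cast; rw [hp]; linarith)
  have h2 : b < 2 * a + 2 := by
    have : (b : ℝ) < 2 * a + 2 := by rw [hp] at hb1; linarith
    exact_mod_cast this
  have hab : ((2 * a : ℕ) : ℝ) / 2 ^ (n + 1) = (a : ℝ) / 2 ^ n := by
    rw [hp]; push_cast; field_simp
  obtain h | h : b = 2 * a ∨ b = 2 * a + 1 := by omega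
  · rw [h, hab, sub_self, abs_zero]
    positivity
  · have h3 : ((2 * a : ℕ) + 1 : ℝ) = b := by rw [h]; push_cast; ring
    have := abs_dyadic_increment_le hx hr hs ht (n := n + 1) (k := 2 * a) (by rwa [hab])
      (by rw [h3, div_le_iff₀ (by positivity)]; exact hb1)
    rw [h3, hab, abs_sub_comm] at this
    refine this.trans ?_
    rw [mul_comm]
    gcongr ?_ * ?_
    exact pow_le_pow_of_le_one hr.le hr1.le (by omega)

theorem abs_dyadic_refine_ceil_le (hx : Summable fun n => dyadicEnergy x n 0 1 / (r ^ n) ^ 2)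
    (hr : 0 < r) (hr1 : r < 1) {s t : ℝ} (hs : 0 ≤ s) (ht : t ≤ 1) {n : ℕ}
    (hn : (⌈s * 2 ^ n⌉₊ : ℝ) / 2 ^ n ≤ t) :
    |x ((⌈s * 2 ^ n⌉₊ : ℝ) / 2 ^ n) - x ((⌈s * 2 ^ (n + 1)⌉₊ : ℝ) / 2 ^ (n + 1))| ≤
      √(dyadicControl x r s t) * r ^ n := by
  set a := ⌈s * 2 ^ n⌉₊
  set b := ⌈s * 2 ^ (n + 1)⌉₊ with hb
  have hp : (2 : ℝ) ^ (n + 1) = 2 * 2 ^ n := by ring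
  have ha1 : s * 2 ^ n ≤ a := Nat.le_ceil _
  have ha2 : (a : ℝ) < s * 2 ^ n + 1 := Nat.ceil_lt_add_one (by positivity)
  have hb1 : s * 2 ^ (n + 1) ≤ b := Nat.le_ceil _
  have h1 : b ≤ 2 * a := Nat.ceil_le.2 (by push_cast; rw [hp]; linarith)
  have h2 : 2 * a < b + 2 := by
    have : (2 * a : ℝ) < b + 2 := by rw [hp] at hb1; linarith
    exact_mod_cast this
  have hab : ((2 * a : ℕ) : ℝ) / 2 ^ (n + 1) = (a : ℝ) / 2 ^ n := by
    rw [hp]; push_cast; field_simp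
  obtain h | h : 2 * a = b ∨ 2 * a = b + 1 := by omega
  · rw [← h, hab, sub_self, abs_zero]
    positivity
  · have h3 : ((b : ℝ) + 1) / 2 ^ (n + 1) = (a : ℝ) / 2 ^ n := by
      rw [← hab, h]; push_cast; ring
    have := abs_dyadic_increment_le hx hr hs ht (n := n + 1) (k := b)
      (by rw [le_div_iff₀ (by positivity)]; exact hb1) (by rwa [h3])
    rw [h3] at this
    refine this.trans ?_
    rw [mul_comm]
    gcongr ?_ * ?_
    exact pow_le_pow_of_le_one hr.le hr1.le (by omega)

theorem tendsto_two_pow_atTop : Tendsto (fun n : ℕ => (2 : ℝ) ^ n) atTop atTop :=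
  tendsto_pow_atTop_atTop_of_one_lt one_lt_two

/-- Dyadic chaining. -/
theorem abs_sub_le_dyadicControl (hc : Continuous x)
    (hx : Summable fun n => dyadicEnergy x n 0 1 / (r ^ n) ^ 2)
    (hr : 0 < r) (hr1 : r < 1) {s t : ℝ} (hs : 0 ≤ s) (hst : s ≤ t) (ht : t ≤ 1) {m : ℕ}
    (hm : t - s ≤ (1 / 2) ^ m) :
    |x t - x s| ≤ 4 / (1 - r) * r ^ m * √(dyadicControl x r s t) := by
  have hr1' : 0 < 1 - r := by linarith
  obtain rfl | hlt := hst.eq_or_lt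
  · rw [sub_self, abs_zero]
    positivity
  -- With `2^-(p+1) < t - s ≤ 2^-p`, the level `p + 1` has a point in `[s, t]`, and its extreme
  -- points there are at most two steps apart. The constant `4` below is `2` for these steps plus
  -- `1` for each chain towards an endpoint.
  obtain ⟨p, hp1, hp2⟩ := exists_nat_pow_near_of_lt_one (x := t - s) (y := (1 / 2 : ℝ))
    (by linarith) (by linarith) (by norm_num) (by norm_num)
  set w := √(dyadicControl x r s t) with hw
  have hmp : m ≤ p + 1 := by
    by_contra h
    have : (1 / 2 : ℝ) ^ m ≤ (1 / 2) ^ (p + 1) :=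
      pow_le_pow_of_le_one (by norm_num) (by norm_num) (by omega)
    linarith
  have hgap : ∀ n, p + 1 ≤ n → ⌈s * 2 ^ n⌉₊ ≤ ⌊t * 2 ^ n⌋₊ := by
    intro n hn
    refine Nat.le_floor ((Nat.ceil_lt_add_one (by positivity)).le.trans ?_)
    have h1 : (1 / 2 : ℝ) ^ n ≤ t - s :=
      (pow_le_pow_of_le_one (by norm_num) (by norm_num) hn).trans hp1.le
    rw [one_div_pow, div_le_iff₀ (by positivity)] at h1
    linarith
  have hceil : ∀ n, s ≤ (⌈s * 2 ^ n⌉₊ : ℝ) / 2 ^ n := fun n => by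
    rw [le_div_iff₀ (by positivity)]
    exact Nat.le_ceil _
  have hfloor : ∀ n, (⌊t * 2 ^ n⌋₊ : ℝ) / 2 ^ n ≤ t := fun n => by
    rw [div_le_iff₀ (by positivity)]
    exact Nat.floor_le (by have := hs.trans hst; positivity)
  have hmid : ∀ n, p + 1 ≤ n → (⌈s * 2 ^ n⌉₊ : ℝ) / 2 ^ n ≤ (⌊t * 2 ^ n⌋₊ : ℝ) / 2 ^ n := by
    intro n hn
    gcongr
    exact hgap n hn
  have hA : |x ((⌊t * 2 ^ (p + 1)⌋₊ : ℝ) / 2 ^ (p + 1)) - x t| ≤ w * r ^ (p + 1) / (1 - r) := by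
    have hlim : Tendsto (fun n : ℕ => x ((⌊t * 2 ^ (p + 1 + n)⌋₊ : ℝ) / 2 ^ (p + 1 + n))) atTop
        (𝓝 (x t)) := (hc.tendsto t).comp <|
      ((tendsto_nat_floor_mul_div_atTop (hs.trans hst)).comp tendsto_two_pow_atTop).comp
        (tendsto_add_atTop_nat (p + 1) |>.congr fun n => by ring)
    have := dist_le_of_le_geometric_of_tendsto₀ r (w * r ^ (p + 1)) hr1 (fun n => by
      rw [Real.dist_eq, mul_assoc, ← pow_add, ← add_assoc]
      exact abs_dyadic_refine_floor_le hx hr hr1 hs hst ht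
        ((hceil _).trans (hmid _ (by omega)))) hlim
    simpa [Real.dist_eq] using this
  have hB : |x ((⌈s * 2 ^ (p + 1)⌉₊ : ℝ) / 2 ^ (p + 1)) - x s| ≤ w * r ^ (p + 1) / (1 - r) := by
    have hlim : Tendsto (fun n : ℕ => x ((⌈s * 2 ^ (p + 1 + n)⌉₊ : ℝ) / 2 ^ (p + 1 + n))) atTop
        (𝓝 (x s)) := (hc.tendsto s).comp <|
      ((tendsto_nat_ceil_mul_div_atTop hs).comp tendsto_two_pow_atTop).comp
        (tendsto_add_atTop_nat (p + 1) |>.congr fun n => by ring)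
    have := dist_le_of_le_geometric_of_tendsto₀ r (w * r ^ (p + 1)) hr1 (fun n => by
      rw [Real.dist_eq, mul_assoc, ← pow_add, ← add_assoc]
      exact abs_dyadic_refine_ceil_le hx hr hr1 hs ht
        ((hmid _ (by omega)).trans (hfloor _))) hlim
    simpa [Real.dist_eq] using this
  have hC : |x ((⌊t * 2 ^ (p + 1)⌋₊ : ℝ) / 2 ^ (p + 1)) -
      x ((⌈s * 2 ^ (p + 1)⌉₊ : ℝ) / 2 ^ (p + 1))| ≤ 2 * (w * r ^ (p + 1) / (1 - r)) := by
    have h1 : ⌊t * 2 ^ (p + 1)⌋₊ ≤ ⌈s * 2 ^ (p + 1)⌉₊ + 1 + 1 := by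
      have h2 : (⌊t * 2 ^ (p + 1)⌋₊ : ℝ) ≤ t * 2 ^ (p + 1) :=
        Nat.floor_le (by have := hs.trans hst; positivity)
      have h3 : s * 2 ^ (p + 1) ≤ ⌈s * 2 ^ (p + 1)⌉₊ := Nat.le_ceil _
      have h4 : (t - s) * 2 ^ (p + 1) ≤ 2 := by
        rw [one_div_pow, le_div_iff₀ (by positivity)] at hp2
        rw [pow_succ]
        linarith
      have : (⌊t * 2 ^ (p + 1)⌋₊ : ℝ) ≤ ⌈s * 2 ^ (p + 1)⌉₊ + 1 + 1 := by linarith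
      exact_mod_cast this
    have h5 := hgap (p + 1) le_rfl
    have h6 : w * r ^ (p + 1) ≤ w * r ^ (p + 1) / (1 - r) :=
      le_div_self (by positivity) hr1' (by linarith)
    have h7 := hceil (p + 1)
    have h8 := hfloor (p + 1)
    generalize ⌈s * 2 ^ (p + 1)⌉₊ = a at *
    generalize ⌊t * 2 ^ (p + 1)⌋₊ = b at *
    have hstep : ∀ k, a ≤ k → k + 1 ≤ b → |x (((k : ℝ) + 1) / 2 ^ (p + 1)) -
        x ((k : ℝ) / 2 ^ (p + 1))| ≤ w * r ^ (p + 1) := fun k hak hkb => by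
      rw [mul_comm]
      refine abs_dyadic_increment_le hx hr hs ht (h7.trans ?_) (le_trans ?_ h8)
      · gcongr
      · have : (k : ℝ) + 1 ≤ b := by exact_mod_cast hkb
        gcongr
    have hw0 : 0 ≤ w * r ^ (p + 1) := by positivity
    obtain rfl | rfl | rfl : b = a ∨ b = a + 1 ∨ b = a + 1 + 1 := by omega
    · rw [sub_self, abs_zero]
      linarith
    · have := hstep a le_rfl le_rfl
      push_cast
      linarith
    · have h9 := hstep a le_rfl (by omega)
      have h10 := hstep (a + 1) (by omega) le_rfl
      push_cast at h9 h10 ⊢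
      have := abs_sub_le (x (((a : ℝ) + 1 + 1) / 2 ^ (p + 1))) (x (((a : ℝ) + 1) / 2 ^ (p + 1)))
        (x ((a : ℝ) / 2 ^ (p + 1)))
      linarith
  have hsum : |x t - x s| ≤ 4 * (w * r ^ (p + 1) / (1 - r)) := by
    rw [abs_le] at *
    constructor <;> linarith [hA.1, hA.2, hB.1, hB.2, hC.1, hC.2]
  refine hsum.trans ?_
  have hrm : r ^ (p + 1) ≤ r ^ m := pow_le_pow_of_le_one hr.le hr1.le hmp
  rw [show 4 / (1 - r) * r ^ m * w = 4 * (w * r ^ m / (1 - r)) by ring]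
  gcongr

end Control

/-! ### The Young integral -/

theorem sum_range_two_mul {M : Type*} [AddCommMonoid M] (f : ℕ → M) (N : ℕ) :
    ∑ i ∈ Finset.range (2 * N), f i = ∑ k ∈ Finset.range N, (f (2 * k) + f (2 * k + 1)) := by
  induction N with
  | zero => simp
  | succ N ih =>
    rw [show 2 * (N + 1) = 2 * N + 1 + 1 by ring, Finset.sum_range_succ, Finset.sum_range_succ, ih,
      Finset.sum_range_succ, add_assoc]

/-- The left Riemann sum of `g` against `x` over the dyadic intervals of level `n` in `[0, t]`. -/
noncomputable def dyadicRiemannSum (g x : ℝ → ℝ) (n : ℕ) (t : ℝ) : ℝ :=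
  ∑ k ∈ Finset.range (2 ^ n), g ((k : ℝ) / 2 ^ n) *
    (x (min (((k : ℝ) + 1) / 2 ^ n) t) - x (min ((k : ℝ) / 2 ^ n) t))

theorem dyadicRiemannSum_zero (g x : ℝ → ℝ) (n : ℕ) : dyadicRiemannSum g x n 0 = 0 :=
  Finset.sum_eq_zero fun k _ => by
    rw [min_eq_right (by positivity), min_eq_right (by positivity), sub_self, mul_zero]

/-- Inserting midpoints changes the value of `g` only on the right half of each interval. -/
theorem dyadicRiemannSum_succ_sub (g x : ℝ → ℝ) (n : ℕ) (t : ℝ) :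
    dyadicRiemannSum g x (n + 1) t - dyadicRiemannSum g x n t = ∑ k ∈ Finset.range (2 ^ n),
      (g (((k : ℝ) + 1 / 2) / 2 ^ n) - g ((k : ℝ) / 2 ^ n)) *
        (x (min (((k : ℝ) + 1) / 2 ^ n) t) - x (min (((k : ℝ) + 1 / 2) / 2 ^ n) t)) := by
  unfold dyadicRiemannSum
  rw [pow_succ', sum_range_two_mul, ← Finset.sum_sub_distrib]
  refine Finset.sum_congr rfl fun k _ => ?_
  have hp : (2 : ℝ) ^ (n + 1) = 2 * 2 ^ n := by ring
  have h1 : ((2 * k : ℕ) : ℝ) / 2 ^ (n + 1) = (k : ℝ) / 2 ^ n := by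
    rw [hp]; push_cast; field_simp
  have h2 : (((2 * k : ℕ) : ℝ) + 1) / 2 ^ (n + 1) = ((k : ℝ) + 1 / 2) / 2 ^ n := by
    rw [hp]; push_cast; field_simp
  have h3 : ((2 * k + 1 : ℕ) : ℝ) / 2 ^ (n + 1) = ((k : ℝ) + 1 / 2) / 2 ^ n := by
    rw [hp]; push_cast; field_simp
  have h4 : (((2 * k + 1 : ℕ) : ℝ) + 1) / 2 ^ (n + 1) = ((k : ℝ) + 1) / 2 ^ n := by
    rw [hp]; push_cast; field_simp; ring
  rw [h1, h2, h3, h4]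
  ring

/-- The difference of the paths stopped at `t` and at `s` has the increments of the path clamped to
`[s, t]`. Hence increments of stopped Riemann sums are Riemann sums over `[s, t]`. -/
theorem sub_min_sub_min (x : ℝ → ℝ) {s t a b : ℝ} (hst : s ≤ t) :
    (x (min b t) - x (min a t)) - (x (min b s) - x (min a s)) =
      x (max s (min b t)) - x (max s (min a t)) := by
  have h : ∀ b, x (min b t) - x (min b s) = x (max s (min b t)) - x s := by
    intro b
    rcases le_total b s with hb | hb
    · rw [min_eq_left hb, min_eq_left (hb.trans hst), max_eq_left hb, sub_self, sub_self]
    · rw [min_eq_right hb, max_eq_right (le_min hb hst)]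
  linarith [h a, h b]

section Young

variable {g x : ℝ → ℝ} {r q L : ℝ}

theorem sum_sqrt_le_sqrt_mul_sqrt {κ : Type*} (s : Finset κ) {a b : κ → ℝ} (ha : ∀ i ∈ s, 0 ≤ a i)
    (hb : ∀ i ∈ s, 0 ≤ b i) :
    ∑ i ∈ s, √(a i) * √(b i) ≤ √(∑ i ∈ s, a i) * √(∑ i ∈ s, b i) := by
  rw [← Real.sqrt_mul (Finset.sum_nonneg ha)]
  refine Real.le_sqrt_of_sq_le ((Finset.sum_mul_sq_le_sq_mul_sq s _ _).trans_eq ?_)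
  rw [Finset.sum_congr rfl fun i hi => Real.sq_sqrt (ha i hi),
    Finset.sum_congr rfl fun i hi => Real.sq_sqrt (hb i hi)]

/-- At most `2^n (t - s) + 2` dyadic intervals contribute. Cauchy–Schwarz together with
superadditivity of the control costs only the square root of this number, which makes up for the
half power lost in the bound on single increments. -/
theorem abs_sum_mul_clamp_increment_le (hc : Continuous x)
    (hx : Summable fun n => dyadicEnergy x n 0 1 / (r ^ n) ^ 2) (hr : 0 < r) (hr1 : r < 1)
    {s t : ℝ} (hs : 0 ≤ s) (hst : s ≤ t) (ht : t ≤ 1) (n : ℕ) {h a b : ℕ → ℝ} {A : ℝ}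
    (hA : 0 ≤ A) (ha : ∀ k : ℕ, (k : ℝ) / 2 ^ n ≤ a k) (hab : ∀ k, a k ≤ b k)
    (hb : ∀ k : ℕ, b k ≤ ((k : ℝ) + 1) / 2 ^ n)
    (hh : ∀ k : ℕ, s < ((k : ℝ) + 1) / 2 ^ n → (k : ℝ) / 2 ^ n < t → |h k| ≤ A) :
    |∑ k ∈ Finset.range (2 ^ n), h k * (x (max s (min (b k) t)) - x (max s (min (a k) t)))| ≤
      A * (4 / (1 - r) * r ^ n) * (√(2 ^ n * (t - s) + 2) * √(dyadicControl x r s t)) := by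
  have hr1' : 0 < 1 - r := by linarith
  have ht0 : 0 ≤ t := hs.trans hst
  set cl : ℝ → ℝ := fun y => max s (min y t) with hcl
  have hcls : ∀ y, s ≤ cl y := fun y => le_max_left _ _
  have hclt : ∀ y, cl y ≤ t := fun y => max_le hst (min_le_right _ _)
  have hclmono : Monotone cl := fun y z hyz => max_le_max le_rfl (min_le_min hyz le_rfl)
  have hcllip : ∀ y z, y ≤ z → cl z - cl y ≤ z - y := by
    intro y z hyz
    simp only [hcl]
    rcases le_total y t with h1 | h1 <;> rcases le_total z t with h2 | h2 <;>
    rcases le_total s y with h3 | h3 <;> rcases le_total s z with h4 | h4 <;>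
    simp [*] <;> linarith
  set T : Finset ℕ := (Finset.range (2 ^ n)).filter fun k =>
    s < ((k : ℝ) + 1) / 2 ^ n ∧ (k : ℝ) / 2 ^ n < t with hT
  have hcard : (T.card : ℝ) ≤ 2 ^ n * (t - s) + 2 := by
    have h1 : T ⊆ Finset.Ico ⌊s * 2 ^ n⌋₊ (⌊t * 2 ^ n⌋₊ + 1) := by
      intro k hk
      obtain ⟨-, hk1, hk2⟩ := Finset.mem_filter.1 hk
      rw [lt_div_iff₀ (by positivity)] at hk1
      rw [div_lt_iff₀ (by positivity)] at hk2
      refine Finset.mem_Ico.2 ⟨?_, Nat.lt_succ_of_le (Nat.le_floor hk2.le)⟩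
      exact Nat.lt_succ_iff.1 ((Nat.floor_lt (by positivity)).2 (by exact_mod_cast hk1))
    have h2 := Finset.card_le_card h1
    rw [Nat.card_Ico] at h2
    have h3 : ⌊s * 2 ^ n⌋₊ ≤ ⌊t * 2 ^ n⌋₊ + 1 := by
      have : ⌊s * 2 ^ n⌋₊ ≤ ⌊t * 2 ^ n⌋₊ := by gcongr
      omega
    have h4 : (T.card : ℝ) ≤ ⌊t * 2 ^ n⌋₊ + 1 - ⌊s * 2 ^ n⌋₊ := by
      have : ((⌊t * 2 ^ n⌋₊ + 1 - ⌊s * 2 ^ n⌋₊ : ℕ) : ℝ) = ⌊t * 2 ^ n⌋₊ + 1 - ⌊s * 2 ^ n⌋₊ := by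
        rw [Nat.cast_sub h3]; push_cast; ring
      rw [← this]
      exact_mod_cast h2
    have h5 : (⌊t * 2 ^ n⌋₊ : ℝ) ≤ t * 2 ^ n := Nat.floor_le (by positivity)
    have h6 := Nat.lt_floor_add_one (s * 2 ^ n)
    linarith
  have hzero : ∀ k ∈ Finset.range (2 ^ n), k ∉ T → h k * (x (cl (b k)) - x (cl (a k))) = 0 := by
    intro k hk hkT
    have : cl (b k) = cl (a k) := by
      by_cases h1 : s < ((k : ℝ) + 1) / 2 ^ n
      · have h2 : t ≤ (k : ℝ) / 2 ^ n := by
          by_contra h2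
          exact hkT (Finset.mem_filter.2 ⟨hk, h1, not_le.1 h2⟩)
        simp only [hcl]
        rw [min_eq_right (h2.trans (ha k)), min_eq_right (h2.trans ((ha k).trans (hab k)))]
      · have h2 : b k ≤ s := (hb k).trans (not_lt.1 h1)
        simp only [hcl]
        rw [max_eq_left ((min_le_left _ _).trans h2),
          max_eq_left ((min_le_left _ _).trans ((hab k).trans h2))]
    rw [this, sub_self, mul_zero]
  -- The factor `√1` prepares Cauchy–Schwarz, where it becomes the square root of the number of
  -- intervals.
  have hterm : ∀ k ∈ T, |h k * (x (cl (b k)) - x (cl (a k)))| ≤ A * (4 / (1 - r) * r ^ n) *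
      (√1 * √(dyadicControl x r (cl ((k : ℝ) / 2 ^ n)) (cl (((k + 1 : ℕ) : ℝ) / 2 ^ n)))) := by
    intro k hk
    obtain ⟨-, hk1, hk2⟩ := Finset.mem_filter.1 hk
    rw [abs_mul, Real.sqrt_one, one_mul, mul_assoc]
    refine mul_le_mul (hh k hk1 hk2) ?_ (abs_nonneg _) hA
    have hlen : cl (b k) - cl (a k) ≤ (1 / 2) ^ n := by
      refine (hcllip _ _ (hab k)).trans ?_
      have : ((k : ℝ) + 1) / 2 ^ n = (k : ℝ) / 2 ^ n + (1 / 2) ^ n := by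
        rw [one_div_pow]; ring
      linarith [ha k, hb k]
    refine (abs_sub_le_dyadicControl hc hx hr hr1 (hs.trans (hcls _)) (hclmono (hab k))
      ((hclt _).trans ht) hlen).trans ?_
    gcongr
    exact dyadicControl_mono hx (hs.trans (hcls _)) (hclmono (ha k))
      (hclmono (by push_cast; exact hb k)) ((hclt _).trans ht)
  rw [← Finset.sum_subset (Finset.filter_subset _ _) hzero]
  refine (Finset.abs_sum_le_sum_abs _ _).trans ((Finset.sum_le_sum hterm).trans ?_)
  rw [← Finset.mul_sum]
  gcongr
  refine (sum_sqrt_le_sqrt_mul_sqrt T (fun _ _ => zero_le_one)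
    fun k _ => dyadicControl_nonneg _ _ _ _).trans ?_
  gcongr
  · simpa using hcard
  · refine (Finset.sum_le_sum_of_subset_of_nonneg (Finset.filter_subset _ _)
      fun k _ _ => dyadicControl_nonneg _ _ _ _).trans ?_
    refine (sum_dyadicControl_le (t := fun k : ℕ => cl ((k : ℝ) / 2 ^ n)) hx (hs.trans (hcls _))
      (fun k _ => hclmono (by gcongr; simp)) ((hclt _).trans ht)).trans ?_
    exact dyadicControl_mono hx hs (hcls _) (hclt _) ht

/-- The remainder estimate for the Young integral `J`. -/
theorem exists_young_primitive (hc : Continuous x)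
    (hx : Summable fun n => dyadicEnergy x n 0 1 / (r ^ n) ^ 2) (hr : 0 < r) (hr1 : r < 1)
    (hq : 0 < q) (hqr : √2 * (q * r) < 1) (hL : 0 ≤ L)
    (hg : ∀ m : ℕ, ∀ u v : ℝ, |u - v| ≤ 2 * (1 / 2) ^ m → |g u - g v| ≤ L * q ^ m) :
    ∃ (J : ℝ → ℝ) (K : ℝ), 0 ≤ K ∧ ∀ s c t : ℝ, 0 ≤ s → s ≤ c → c ≤ t → t ≤ 1 →
      ∀ m : ℕ, t - s ≤ (1 / 2) ^ m →
        |g c * (x t - x s) - (J t - J s)| ≤ K * (q * r) ^ m * √(dyadicControl x r s t) := by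
  have hr1' : 0 < 1 - r := by linarith
  have hk1' : 0 < 1 - √2 * (q * r) := by linarith
  set S := dyadicRiemannSum g x
  set B : ℝ := L * (4 / (1 - r)) * 2
  have hB : 0 ≤ B := by positivity
  have hcount : ∀ m n : ℕ, ∀ s t : ℝ, t - s ≤ (1 / 2) ^ m →
      √(2 ^ (m + n) * (t - s) + 2) ≤ 2 * √2 ^ n := by
    intro m n s t hm
    refine Real.sqrt_le_iff.2 ⟨by positivity, ?_⟩
    rw [mul_pow, ← pow_mul, mul_comm n 2, pow_mul, Real.sq_sqrt (by norm_num)]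
    have h1 : (2 : ℝ) ^ (m + n) * (t - s) ≤ 2 ^ (m + n) * (1 / 2) ^ m := by gcongr
    have h2 : (2 : ℝ) ^ (m + n) * (1 / 2) ^ m = 2 ^ n := by
      rw [pow_add, one_div_pow]; field_simp
    have h3 : (1 : ℝ) ≤ 2 ^ n := one_le_pow₀ (by norm_num)
    linarith
  have hstep : ∀ s t : ℝ, 0 ≤ s → s ≤ t → t ≤ 1 → ∀ m n : ℕ, t - s ≤ (1 / 2) ^ m →
      |(S (m + n) t - S (m + n) s) - (S (m + n + 1) t - S (m + n + 1) s)| ≤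
        B * (q * r) ^ m * √(dyadicControl x r s t) * (√2 * (q * r)) ^ n := by
    intro s t hs hst ht m n hm
    have h1 : (S (m + n + 1) t - S (m + n + 1) s) - (S (m + n) t - S (m + n) s) =
        ∑ k ∈ Finset.range (2 ^ (m + n)), (g (((k : ℝ) + 1 / 2) / 2 ^ (m + n)) -
          g ((k : ℝ) / 2 ^ (m + n))) * (x (max s (min (((k : ℝ) + 1) / 2 ^ (m + n)) t)) -
            x (max s (min (((k : ℝ) + 1 / 2) / 2 ^ (m + n)) t))) := by
      rw [show (S (m + n + 1) t - S (m + n + 1) s) - (S (m + n) t - S (m + n) s) =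
        (S (m + n + 1) t - S (m + n) t) - (S (m + n + 1) s - S (m + n) s) by ring]
      simp only [S, dyadicRiemannSum_succ_sub]
      rw [← Finset.sum_sub_distrib]
      refine Finset.sum_congr rfl fun k _ => ?_
      rw [← mul_sub, sub_min_sub_min x hst]
    rw [abs_sub_comm, h1]
    refine (abs_sum_mul_clamp_increment_le (A := L * q ^ (m + n)) hc hx hr hr1 hs hst ht (m + n)
      (by positivity) (fun k => by gcongr; linarith) (fun k => by gcongr; norm_num)
      (fun k => le_rfl) fun k _ _ => hg _ _ _ ?_).trans ?_
    · rw [← sub_div, add_sub_cancel_left, abs_of_nonneg (by positivity), one_div_pow]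
      have : (0 : ℝ) < 2 ^ (m + n) := by positivity
      rw [div_le_iff₀ this]
      field_simp
      norm_num
    · calc L * q ^ (m + n) * (4 / (1 - r) * r ^ (m + n)) *
            (√(2 ^ (m + n) * (t - s) + 2) * √(dyadicControl x r s t))
          ≤ L * q ^ (m + n) * (4 / (1 - r) * r ^ (m + n)) *
            ((2 * √2 ^ n) * √(dyadicControl x r s t)) := by
              gcongr
              exact hcount m n s t hm
        _ = _ := by
              simp only [B, mul_pow, pow_add]
              ring
  have hlim : ∀ t, 0 ≤ t → t ≤ 1 → ∃ y, Tendsto (fun n => S n t) atTop (𝓝 y) := by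
    intro t ht0 ht1
    refine cauchySeq_tendsto_of_complete (cauchySeq_of_le_geometric (√2 * (q * r))
      (B * √(dyadicControl x r 0 t)) (by linarith) fun n => ?_)
    have := hstep 0 t le_rfl ht0 ht1 0 n (by simpa using ht1)
    simpa [S, dyadicRiemannSum_zero, Real.dist_eq] using this
  choose! J hJ using hlim
  -- The first `B` compares the one-point sum with the level `m` sum; the second is the geometric
  -- series of refinements from level `m` to the limit.
  refine ⟨J, B + B / (1 - √2 * (q * r)), by positivity, fun s c t hs hsc hct ht m hm => ?_⟩
  have hst := hsc.trans hct
  have h1 : |(S m t - S m s) - (J t - J s)| ≤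
      B * (q * r) ^ m * √(dyadicControl x r s t) / (1 - √2 * (q * r)) := by
    have hl : Tendsto (fun n => S (m + n) t - S (m + n) s) atTop (𝓝 (J t - J s)) := by
      have h2 := ((hJ t (hs.trans hst) ht).sub (hJ s hs (hst.trans ht))).comp
        (tendsto_add_atTop_nat m)
      refine h2.congr fun n => ?_
      simp [add_comm n m]
    have := dist_le_of_le_geometric_of_tendsto₀ (√2 * (q * r)) _ (by linarith)
      (fun n => by rw [Real.dist_eq]; exact hstep s t hs hst ht m n hm) hl
    simpa only [Real.dist_eq, add_zero] using this
  have h2 : |(S m t - S m s) - g c * (x t - x s)| ≤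
      B * (q * r) ^ m * √(dyadicControl x r s t) := by
    have h3 : (S m t - S m s) - g c * (x t - x s) = ∑ k ∈ Finset.range (2 ^ m),
        (g ((k : ℝ) / 2 ^ m) - g c) * (x (max s (min (((k : ℝ) + 1) / 2 ^ m) t)) -
          x (max s (min ((k : ℝ) / 2 ^ m) t))) := by
      have h4 : ∑ k ∈ Finset.range (2 ^ m), (x (max s (min (((k : ℝ) + 1) / 2 ^ m) t)) -
          x (max s (min ((k : ℝ) / 2 ^ m) t))) = x t - x s := by
        have := Finset.sum_range_sub (fun k : ℕ => x (max s (min ((k : ℝ) / 2 ^ m) t))) (2 ^ m)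
        simp only [Nat.cast_add, Nat.cast_one, Nat.cast_pow, Nat.cast_ofNat, Nat.cast_zero,
          zero_div] at this
        rw [this, div_self (by positivity), min_eq_right ht, max_eq_right hst,
          min_eq_left (hs.trans hst), max_eq_left hs]
      simp only [sub_mul]
      rw [Finset.sum_sub_distrib, ← Finset.mul_sum, h4]
      congr 1
      simp only [S, dyadicRiemannSum]
      rw [← Finset.sum_sub_distrib]
      refine Finset.sum_congr rfl fun k _ => ?_
      rw [← mul_sub, sub_min_sub_min x hst]
    rw [h3]
    refine (abs_sum_mul_clamp_increment_le (A := L * q ^ m) hc hx hr hr1 hs hst ht m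
      (by positivity) (fun k => le_rfl) (fun k => by gcongr; linarith)
      (fun k => le_rfl) fun k hk1 hk2 => hg _ _ _ ?_).trans ?_
    -- The left endpoint of an interval meeting `[s, t]` may lie outside it, so its distance to `c`
    -- is bounded only by `2 * 2^-m`; hence the factor `2` in `hg`.
    · have h5 : ((k : ℝ) + 1) / 2 ^ m = (k : ℝ) / 2 ^ m + (1 / 2) ^ m := by
        rw [one_div_pow]; ring
      have : (0 : ℝ) < (1 / 2) ^ m := by positivity
      rw [abs_le]
      constructor <;> linarith
    · calc L * q ^ m * (4 / (1 - r) * r ^ m) *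
            (√(2 ^ m * (t - s) + 2) * √(dyadicControl x r s t))
          ≤ L * q ^ m * (4 / (1 - r) * r ^ m) * (2 * √(dyadicControl x r s t)) := by
              gcongr
              simpa using hcount m 0 s t hm
        _ = _ := by
              simp only [B, mul_pow]
              ring
  rw [abs_sub_comm] at h2
  refine (abs_sub_le _ _ _).trans ((add_le_add h2 h1).trans_eq ?_)
  ring

/-- The primitive `J` telescopes, so the error of a tagged sum is the sum of the local remainders.
Each is at most a small constant times `√(t_{i+1} - t_i) * √(w(t_i, t_{i+1}))`, and Cauchy–Schwarz
bounds the total by `√1 * √(w(0, 1))`. -/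
theorem exists_hasYoungIntegral (hc : Continuous x)
    (hx : Summable fun n => dyadicEnergy x n 0 1 / (r ^ n) ^ 2) (hr : 0 < r) (hr1 : r < 1)
    (hq : 0 < q) (hqr : √2 * (q * r) < 1) (hL : 0 ≤ L)
    (hg : ∀ m : ℕ, ∀ u v : ℝ, |u - v| ≤ 2 * (1 / 2) ^ m → |g u - g v| ≤ L * q ^ m) :
    ∃ y, HasYoungIntegral (fun t => g t) (fun t => x t) y := by
  obtain ⟨J, K, hK, hJ⟩ := exists_young_primitive hc hx hr hr1 hq hqr hL hg
  refine ⟨J 1 - J 0, fun ε hε => ?_⟩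
  set κ := √2 * (q * r)
  have hκ : 0 < κ := by positivity
  set D := K * √2 * √(dyadicControl x r 0 1)
  obtain ⟨M, hM⟩ : ∃ M : ℕ, D * κ ^ M < ε := by
    have := ((tendsto_pow_atTop_nhds_zero_of_lt_one hκ.le hqr).const_mul D)
    rw [mul_zero] at this
    exact (this.eventually (gt_mem_nhds hε)).exists
  refine ⟨(1 / 2) ^ M, by positivity, fun N t c h0 h1 ht => lt_of_le_of_lt ?_ hM⟩
  have hterm : ∀ i ∈ Finset.range N, |g (c i) * (x (t (i + 1)) - x (t i)) -
      (J (t (i + 1)) - J (t i))| ≤ K * √2 * κ ^ M *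
        (√((t (i + 1) : ℝ) - t i) * √(dyadicControl x r (t i) (t (i + 1)))) := by
    intro i hi
    obtain ⟨hi1, hi2, hi3⟩ := ht i (Finset.mem_range.1 hi)
    have hi1' : (t i : ℝ) ≤ c i := hi1
    have hi2' : (c i : ℝ) ≤ t (i + 1) := hi2
    rcases (hi1'.trans hi2').eq_or_lt with heq | hlt
    · rw [heq]
      simp
    obtain ⟨m, hm1, hm2⟩ := exists_nat_pow_near_of_lt_one (x := (t (i + 1) : ℝ) - t i)
      (y := (1 / 2 : ℝ)) (by linarith) (by linarith [(t (i + 1)).2.2, (t i).2.1]) (by norm_num)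
      (by norm_num)
    have hMm : M ≤ m := by
      by_contra h
      have : (1 / 2 : ℝ) ^ M ≤ (1 / 2) ^ (m + 1) :=
        pow_le_pow_of_le_one (by norm_num) (by norm_num) (by omega)
      linarith
    refine (hJ _ _ _ (t i).2.1 hi1' hi2' (t (i + 1)).2.2 m hm2).trans ?_
    -- `(q r)^m = κ^m 2^(-m/2)`: the first factor is small with the mesh, the second is comparable
    -- to the square root of the interval length.
    have h2 : (q * r) ^ m ≤ √2 * κ ^ M * √((t (i + 1) : ℝ) - t i) := by
      have h3 : √((1 / 2 : ℝ) ^ m) ≤ √2 * √((t (i + 1) : ℝ) - t i) := by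
        rw [← Real.sqrt_mul (by norm_num)]
        refine Real.sqrt_le_sqrt ?_
        rw [pow_succ] at hm1
        linarith
      have h4 : √2 ^ m * √((1 / 2 : ℝ) ^ m) = 1 := by
        have h6 : √2 ^ m = √((2 : ℝ) ^ m) := by
          symm
          rw [Real.sqrt_eq_iff_mul_self_eq (by positivity) (by positivity), ← mul_pow,
            Real.mul_self_sqrt (by norm_num)]
        rw [h6, ← Real.sqrt_mul (by positivity), ← mul_pow]
        norm_num
      have h5 : κ ^ m ≤ κ ^ M := pow_le_pow_of_le_one hκ.le hqr.le hMm
      calc (q * r) ^ m = κ ^ m * √((1 / 2 : ℝ) ^ m) := by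
            rw [mul_pow √2, mul_right_comm, h4, one_mul]
        _ ≤ κ ^ M * (√2 * √((t (i + 1) : ℝ) - t i)) := by gcongr
        _ = _ := by ring
    calc K * (q * r) ^ m * √(dyadicControl x r (t i) (t (i + 1)))
        ≤ K * (√2 * κ ^ M * √((t (i + 1) : ℝ) - t i)) *
          √(dyadicControl x r (t i) (t (i + 1))) := by gcongr
      _ = _ := by ring
  have htel : J 1 - J 0 = ∑ i ∈ Finset.range N, (J (t (i + 1)) - J (t i)) := by
    rw [Finset.sum_range_sub (fun i => J (t i)), h0, h1]
    rfl
  have hmono : ∀ i < N, (t i : ℝ) ≤ t (i + 1) := fun i hi => (ht i hi).1.trans (ht i hi).2.1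
  rw [htel, ← Finset.sum_sub_distrib]
  refine (Finset.abs_sum_le_sum_abs _ _).trans ((Finset.sum_le_sum hterm).trans ?_)
  rw [← Finset.mul_sum]
  have hCS := sum_sqrt_le_sqrt_mul_sqrt (Finset.range N)
    (a := fun i => (t (i + 1) : ℝ) - t i)
    (b := fun i => dyadicControl x r (t i) (t (i + 1)))
    (fun i hi => sub_nonneg.2 (hmono i (Finset.mem_range.1 hi)))
    fun i _ => dyadicControl_nonneg _ _ _ _
  have hs1 : ∑ i ∈ Finset.range N, ((t (i + 1) : ℝ) - t i) = 1 := by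
    rw [Finset.sum_range_sub (fun i => (t i : ℝ)), h0, h1]
    simp
  have hs2 := sum_dyadicControl_le (t := fun i => (t i : ℝ)) hx (t 0).2.1 hmono (t N).2.2
  rw [hs1, Real.sqrt_one, one_mul] at hCS
  rw [h0, h1] at hs2
  calc K * √2 * κ ^ M * _ ≤ K * √2 * κ ^ M * √(dyadicControl x r 0 1) := by
        gcongr
        exact hCS.trans (Real.sqrt_le_sqrt hs2)
    _ = _ := by simp only [D]; ring

end Young

/-! ### Dyadic Riemann sums of the kernels -/

/-- The point `k / 2 ^ N` of the unit interval. -/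
noncomputable def dyadicPoint (N k : ℕ) : I :=
  Set.projIcc 0 1 zero_le_one ((k : ℝ) / 2 ^ N)

theorem coe_dyadicPoint {N k : ℕ} (hk : k ≤ 2 ^ N) : (dyadicPoint N k : ℝ) = (k : ℝ) / 2 ^ N := by
  have hk' : (k : ℝ) ≤ 2 ^ N := by exact_mod_cast hk
  have hmem : (k : ℝ) / 2 ^ N ∈ Set.Icc (0 : ℝ) 1 :=
    ⟨by positivity, (div_le_one (by positivity)).2 hk'⟩
  simp only [dyadicPoint, Set.projIcc_of_mem zero_le_one hmem]

theorem dyadicPoint_zero (N : ℕ) : dyadicPoint N 0 = 0 :=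
  Subtype.ext (by rw [coe_dyadicPoint (by positivity)]; simp)

theorem dyadicPoint_two_pow (N : ℕ) : dyadicPoint N (2 ^ N) = 1 :=
  Subtype.ext (by rw [coe_dyadicPoint le_rfl]; simp)

theorem dyadicPoint_lt {N j k : ℕ} (hjk : j < k) (hk : k ≤ 2 ^ N) :
    dyadicPoint N j < dyadicPoint N k := by
  rw [← Subtype.coe_lt_coe, coe_dyadicPoint (hjk.le.trans hk), coe_dyadicPoint hk]
  gcongr

theorem dyadicPoint_two_mul (N k : ℕ) : dyadicPoint (N + 1) (2 * k) = dyadicPoint N k := by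
  unfold dyadicPoint
  congr 1
  rw [pow_succ]
  push_cast
  field_simp

/-- The left Riemann sum of `g` against `f` over the dyadic partition of level `N`. -/
noncomputable def dyadicSum {E : Type*} [AddCommGroup E] [Module ℝ E] (g : I → ℝ) (f : I → E)
    (N : ℕ) : E :=
  ∑ k ∈ Finset.range (2 ^ N),
    g (dyadicPoint N k) • (f (dyadicPoint N (k + 1)) - f (dyadicPoint N k))

theorem dyadicSum_neg {E : Type*} [AddCommGroup E] [Module ℝ E] (g : I → ℝ) (f : I → E)
    (N : ℕ) : dyadicSum (fun u => -g u) f N = -dyadicSum g f N := by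
  simp [dyadicSum]

theorem dyadicSum_succ_sub {E : Type*} [AddCommGroup E] [Module ℝ E] (g : I → ℝ) (f : I → E)
    (N : ℕ) : dyadicSum g f (N + 1) - dyadicSum g f N = ∑ k ∈ Finset.range (2 ^ N),
      (g (dyadicPoint (N + 1) (2 * k + 1)) - g (dyadicPoint (N + 1) (2 * k))) •
        (f (dyadicPoint (N + 1) (2 * k + 1 + 1)) - f (dyadicPoint (N + 1) (2 * k + 1))) := by
  unfold dyadicSum
  rw [pow_succ', sum_range_two_mul, ← Finset.sum_sub_distrib]
  refine Finset.sum_congr rfl fun k _ => ?_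
  rw [← dyadicPoint_two_mul N k, ← dyadicPoint_two_mul N (k + 1),
    show 2 * (k + 1) = 2 * k + 1 + 1 by ring]
  module

section Kernel

variable {E : Type*} [NormedAddCommGroup E]

/-- The kernels are genuinely `θ / 2`-Hölder in norm, so the triangle inequality over `2^N` midpoint
corrections already gives a geometric series of ratio `2pq`. -/
theorem exists_tendsto_dyadicSum [NormedSpace ℝ E] [CompleteSpace E] {g : I → ℝ} {f : I → E}
    {p q C L : ℝ} (hq : 0 < q) (hpq : 2 * (p * q) < 1) (hL : 0 ≤ L)
    (hg : ∀ m : ℕ, ∀ u v : I, |(u : ℝ) - v| ≤ (1 / 2) ^ m → |g u - g v| ≤ L * q ^ m)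
    (hf : ∀ m : ℕ, ∀ u v : I, |(u : ℝ) - v| ≤ (1 / 2) ^ m → ‖f u - f v‖ ≤ C * p ^ m) :
    ∃ v, Tendsto (dyadicSum g f) atTop (𝓝 v) := by
  refine cauchySeq_tendsto_of_complete (cauchySeq_of_le_geometric (2 * (p * q))
    (L * q * (C * p)) hpq fun N => ?_)
  rw [dist_comm, dist_eq_norm, dyadicSum_succ_sub]
  have hpt : ∀ k < 2 ^ (N + 1), |(dyadicPoint (N + 1) (k + 1) : ℝ) - dyadicPoint (N + 1) k| ≤
      (1 / 2) ^ (N + 1) := by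
    intro k hk
    rw [coe_dyadicPoint hk, coe_dyadicPoint hk.le, ← sub_div, one_div_pow]
    push_cast
    rw [add_sub_cancel_left, abs_of_pos (by positivity)]
  have hterm : ∀ k ∈ Finset.range (2 ^ N),
      ‖(g (dyadicPoint (N + 1) (2 * k + 1)) - g (dyadicPoint (N + 1) (2 * k))) •
        (f (dyadicPoint (N + 1) (2 * k + 1 + 1)) - f (dyadicPoint (N + 1) (2 * k + 1)))‖ ≤
        L * q ^ (N + 1) * (C * p ^ (N + 1)) := by
    intro k hk
    have hk' := Finset.mem_range.1 hk
    have h2 : 2 ^ (N + 1) = 2 * 2 ^ N := by ring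
    rw [norm_smul]
    exact mul_le_mul (hg _ _ _ (hpt _ (by omega))) (hf _ _ _ (hpt _ (by omega)))
      (norm_nonneg _) (by positivity)
  refine (norm_sum_le_of_le _ hterm).trans_eq ?_
  simp only [Finset.sum_const, Finset.card_range, nsmul_eq_mul, Nat.cast_pow, Nat.cast_ofNat,
    mul_pow, pow_succ]
  ring

theorem sum_increments (f : I → E) {m : ℕ} (t : Fin (m + 1) → I) :
    ∑ i, increments f t i = f (t (Fin.last m)) - f (t 0) := by
  have h := Fin.sum_univ_castSucc (fun i => f (t i))
  rw [Fin.sum_univ_succ] at h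
  simp only [increments, Finset.sum_sub_distrib]
  rw [sub_eq_sub_iff_add_eq_add, add_comm, h, add_comm]

variable [InnerProductSpace ℝ E]

/-- Pair the sum with the total increment `u`. Each increment has nonnegative inner product with
`u`, so lowering the coefficients to `b` leaves at least `b ‖u‖²`; then apply Cauchy–Schwarz. -/
theorem NonnegRowSum.mul_norm_le {f : I → E} (hf : NonnegRowSum f) {m : ℕ} {t : Fin (m + 1) → I}
    (ht : Monotone t) {a : Fin m → ℝ} {b : ℝ} (ha : ∀ i, b ≤ a i) :
    b * ‖f (t (Fin.last m)) - f (t 0)‖ ≤ ‖∑ i, a i • increments f t i‖ := by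
  set u := f (t (Fin.last m)) - f (t 0) with hu
  have h1 : b * ‖u‖ ^ 2 ≤ ⟪∑ i, a i • increments f t i, u⟫_ℝ := by
    rw [← real_inner_self_eq_norm_sq]
    nth_rewrite 1 [hu]
    rw [← sum_increments, sum_inner, sum_inner, Finset.mul_sum]
    refine Finset.sum_le_sum fun i _ => ?_
    rw [real_inner_smul_left]
    exact mul_le_mul_of_nonneg_right (ha i)
      (hf _ _ _ _ (ht (Fin.zero_le _)) (ht (Fin.castSucc_le_succ i)) (ht (Fin.le_last _)))
  have h2 := h1.trans (real_inner_le_norm _ _)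
  rcases (norm_nonneg u).eq_or_lt with h0 | h0
  · rw [← h0]
    simp
  · rw [sq, ← mul_assoc] at h2
    exact le_of_mul_le_mul_right h2 h0

variable [CompleteSpace E]

/-- The parts of the sum outside the block `[j, j + m]` lie in `U`. Projecting onto `Uᗮ` therefore
leaves `v - U.starProjection v`, and a projection does not increase the norm. -/
theorem KernelNondeterminism.norm_dyadicSum_sq_ge {f : I → E} {β : ℝ}
    (hker : KernelNondeterminism f β) (hrow : NonnegRowSum f) {g : I → ℝ} {b : ℝ} (hb : 0 < b)
    {N j m : ℕ} (hm : 0 < m) (hjm : j + m ≤ 2 ^ N)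
    (hg : ∀ k, j ≤ k → k < j + m → b ≤ g (dyadicPoint N k)) :
    β * (b * ‖f (dyadicPoint N (j + m)) - f (dyadicPoint N j)‖) ^ 2 ≤ ‖dyadicSum g f N‖ ^ 2 := by
  obtain ⟨l, hl⟩ := Nat.exists_eq_add_of_le hjm
  let s : Fin (j + 1) → I := fun i => dyadicPoint N i
  let t : Fin (m + 1) → I := fun i => dyadicPoint N (j + i)
  let r : Fin (l + 1) → I := fun i => dyadicPoint N (j + m + i)
  let a : Fin m → ℝ := fun i => g (dyadicPoint N (j + i))
  have hs : StrictMono s := fun i i' h => dyadicPoint_lt h (by have := i'.2; omega)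
  have ht : StrictMono t := fun i i' h =>
    dyadicPoint_lt (by simpa using h) (by have := i'.2; omega)
  have hr : StrictMono r := fun i i' h =>
    dyadicPoint_lt (by simpa using h) (by have := i'.2; omega)
  have hab : ∀ i, b ≤ a i := fun i => hg _ (by omega) (by have := i.2; omega)
  have ha : a ≠ 0 := fun h => by
    have := hab ⟨0, hm⟩
    rw [h] at this
    exact absurd this (not_le.2 hb)
  set U := (Submodule.span ℝ (Set.range (increments f s) ∪
    Set.range (increments f r))).topologicalClosure with hU
  have hproj := hker.projection m j l t s r a ht hs hr (dyadicPoint_zero N) (by simp [s, t])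
    (by simp [r, t]) ha
  set v := ∑ i, a i • increments f t i
  have hsplit : dyadicSum g f N = (∑ i : Fin j, g (s i.castSucc) • increments f s i) + v +
      ∑ i : Fin l, g (r i.castSucc) • increments f r i := by
    unfold dyadicSum
    rw [hl, Finset.sum_range_add, Finset.sum_range_add]
    simp only [Finset.sum_range]
    rfl
  have hspan : ∀ w ∈ Set.range (increments f s) ∪ Set.range (increments f r), w ∈ U :=
    fun w hw => Submodule.le_topologicalClosure _ (Submodule.subset_span hw)
  have hz1 : (∑ i : Fin j, g (s i.castSucc) • increments f s i) ∈ U :=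
    U.sum_mem fun i _ => U.smul_mem _ (hspan _ (Or.inl ⟨i, rfl⟩))
  have hz2 : (∑ i : Fin l, g (r i.castSucc) • increments f r i) ∈ U :=
    U.sum_mem fun i _ => U.smul_mem _ (hspan _ (Or.inr ⟨i, rfl⟩))
  have hres : v - U.starProjection v = Uᗮ.starProjection (dyadicSum g f N) := by
    rw [Submodule.starProjection_orthogonal', hsplit]
    simp only [sub_apply, one_apply_eq_self, map_add,
      Submodule.starProjection_eq_self_iff.2 hz1, Submodule.starProjection_eq_self_iff.2 hz2]
    abel
  have hle : ‖v - U.starProjection v‖ ≤ ‖dyadicSum g f N‖ := by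
    rw [hres]
    exact Submodule.norm_starProjection_apply_le _ _
  have h1 : b * ‖f (dyadicPoint N (j + m)) - f (dyadicPoint N j)‖ ≤ ‖v‖ := by
    simpa [t] using hrow.mul_norm_le ht.monotone hab
  have hβ := hker.pos
  calc β * (b * ‖f (dyadicPoint N (j + m)) - f (dyadicPoint N j)‖) ^ 2
      ≤ β * ‖v‖ ^ 2 := by gcongr
    _ ≤ ‖v - U.starProjection v‖ ^ 2 := hproj.le
    _ ≤ ‖dyadicSum g f N‖ ^ 2 := by gcongr

/-- Rounding `s` up and `t` down to level `N` keeps the block inside `[s, t]`, where `g ≥ b`;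
continuity of `f` then permits the limit. -/
theorem KernelNondeterminism.norm_limit_sq_ge_of_le {f : I → E} {β : ℝ}
    (hker : KernelNondeterminism f β) (hrow : NonnegRowSum f) (hf : Continuous f) {g : I → ℝ}
    {b : ℝ} (hb : 0 < b) {s t : I} (hst : s < t) (hg : ∀ u, s ≤ u → u ≤ t → b ≤ g u) {v : E}
    (hv : Tendsto (dyadicSum g f) atTop (𝓝 v)) :
    β * (b * ‖f t - f s‖) ^ 2 ≤ ‖v‖ ^ 2 := by
  have hst' : (0 : ℝ) < t - s := sub_pos.2 hst
  have hlim : ∀ (u : I) (k : ℕ → ℕ),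
      Tendsto (fun N => (k N : ℝ) / 2 ^ N) atTop (𝓝 u) →
      Tendsto (fun N => f (dyadicPoint N (k N))) atTop (𝓝 (f u)) := by
    intro u k hk
    have := ((hf.comp (continuous_projIcc (h := zero_le_one))).tendsto (u : ℝ)).comp hk
    rwa [Function.comp_apply, Set.projIcc_val] at this
  have h1 := hlim t _ ((tendsto_nat_floor_mul_div_atTop t.2.1).comp tendsto_two_pow_atTop)
  have h2 := hlim s _ ((tendsto_nat_ceil_mul_div_atTop s.2.1).comp tendsto_two_pow_atTop)
  refine le_of_tendsto_of_tendsto ((((h1.sub h2).norm.const_mul b).pow 2).const_mul β)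
    (hv.norm.pow 2) ?_
  filter_upwards [tendsto_two_pow_atTop.eventually_gt_atTop (2 / ((t : ℝ) - s))] with N hN
  rw [div_lt_iff₀ hst'] at hN
  set j := ⌈(s : ℝ) * 2 ^ N⌉₊ with hj
  set k := ⌊(t : ℝ) * 2 ^ N⌋₊ with hk
  have hs0 := s.2.1
  have ht0 := t.2.1
  have hj1 : (s : ℝ) * 2 ^ N ≤ j := Nat.le_ceil _
  have hj2 : (j : ℝ) < s * 2 ^ N + 1 := Nat.ceil_lt_add_one (by positivity)
  have hk1 : (k : ℝ) ≤ t * 2 ^ N := Nat.floor_le (by positivity)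
  have hk2 : (t : ℝ) * 2 ^ N < k + 1 := Nat.lt_floor_add_one _
  have hjk : j < k := by
    have : (j : ℝ) < k := by linarith
    exact_mod_cast this
  obtain ⟨m, hm⟩ := Nat.exists_eq_add_of_le hjk.le
  have hk3 : k ≤ 2 ^ N := by
    have : (k : ℝ) ≤ 2 ^ N := hk1.trans (mul_le_of_le_one_left (by positivity) t.2.2)
    exact_mod_cast this
  have := hker.norm_dyadicSum_sq_ge hrow hb (N := N) (j := j) (m := m) (g := g) (by omega)
    (by omega) fun i hi1 hi2 => by
      have hi1' : (j : ℝ) ≤ i := by exact_mod_cast hi1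
      have hi2' : (i : ℝ) ≤ k := by exact_mod_cast (by omega : i ≤ k)
      refine hg _ ?_ ?_
      · rw [← Subtype.coe_le_coe, coe_dyadicPoint (by omega), le_div_iff₀ (by positivity)]
        linarith
      · rw [← Subtype.coe_le_coe, coe_dyadicPoint (by omega), div_le_iff₀ (by positivity)]
        linarith
  rwa [← hm] at this

theorem KernelNondeterminism.norm_limit_sq_ge {f : I → E} {β : ℝ}
    (hker : KernelNondeterminism f β) (hrow : NonnegRowSum f) (hf : Continuous f) {g : I → ℝ}
    {b : ℝ} (hb : 0 < b) {s t : I} (hst : s < t)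
    (hg : (∀ u, s ≤ u → u ≤ t → b ≤ g u) ∨ ∀ u, s ≤ u → u ≤ t → b ≤ -g u) {v : E}
    (hv : Tendsto (dyadicSum g f) atTop (𝓝 v)) :
    β * (b * ‖f t - f s‖) ^ 2 ≤ ‖v‖ ^ 2 := by
  rcases hg with hg | hg
  · exact hker.norm_limit_sq_ge_of_le hrow hf hb hst hg hv
  · rw [← norm_neg v]
    refine hker.norm_limit_sq_ge_of_le hrow hf hb hst hg (hv.neg.congr fun N => ?_)
    rw [dyadicSum_neg]

end Kernel

/-! ### Mean square limits -/

/-- Fatou's lemma bounds the distance of `Z n` to the almost sure limit by the limit of its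
distances to `Z m`, which the isometry expresses through `v`. Measurability of `Y` also comes from
the almost sure convergence. -/
theorem memLp_and_tendsto_of_isometry {Ω E : Type*} [MeasurableSpace Ω] {P : Measure Ω}
    [NormedAddCommGroup E] {Z : ℕ → Ω → ℝ} {Y : Ω → ℝ} {v : ℕ → E} {w : E} {κ : ℝ}
    (hZ : ∀ n, MemLp (Z n) 2 P)
    (hY : ∀ᵐ ω ∂P, Tendsto (fun n => Z n ω) atTop (𝓝 (Y ω)))
    (hiso : ∀ m n, ∫ ω, (Z n ω - Z m ω) ^ 2 ∂P = κ * ‖v n - v m‖ ^ 2)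
    (hv : Tendsto v atTop (𝓝 w)) :
    MemLp Y 2 P ∧ Tendsto (fun n => eLpNorm (fun ω => Z n ω - Y ω) 2 P) atTop (𝓝 0) := by
  have hmeas : AEStronglyMeasurable Y P :=
    aestronglyMeasurable_of_tendsto_ae atTop (fun n => (hZ n).1) hY
  have hle : ∀ n, eLpNorm (fun ω => Z n ω - Y ω) 2 P ≤
      ENNReal.ofReal √(κ * ‖v n - w‖ ^ 2) := by
    intro n
    have h1 : ∀ m, eLpNorm (fun ω => Z n ω - Z m ω) 2 P =
        ENNReal.ofReal √(κ * ‖v n - v m‖ ^ 2) := fun m => by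
      rw [← hiso]
      exact eLpNorm_two_eq_sqrt ((hZ n).sub (hZ m))
    have h2 := Lp.eLpNorm_lim_le_liminf_eLpNorm (p := 2) (μ := P)
      (f := fun m ω => Z n ω - Z m ω) (fun m => ((hZ n).sub (hZ m)).1) (fun ω => Z n ω - Y ω)
      (hY.mono fun ω hω => tendsto_const_nhds.sub hω)
    simp only [h1] at h2
    have h3 : Tendsto (fun m => ENNReal.ofReal √(κ * ‖v n - v m‖ ^ 2)) atTop
        (𝓝 (ENNReal.ofReal √(κ * ‖v n - w‖ ^ 2))) :=
      ENNReal.tendsto_ofReal (((hv.const_sub (v n)).norm.pow 2).const_mul κ).sqrt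
    rwa [h3.liminf_eq] at h2
  have hdiff : ∀ n, MemLp (fun ω => Z n ω - Y ω) 2 P := fun n =>
    ⟨(hZ n).1.sub hmeas, (hle n).trans_lt ENNReal.ofReal_lt_top⟩
  refine ⟨?_, ?_⟩
  · have := (hZ 0).sub (hdiff 0)
    refine this.ae_eq (ae_of_all _ fun ω => ?_)
    simp
  · have h3 : Tendsto (fun n => ENNReal.ofReal √(κ * ‖v n - w‖ ^ 2)) atTop (𝓝 0) := by
      have := ENNReal.tendsto_ofReal (((hv.sub_const w).norm.pow 2).const_mul κ).sqrt
      simpa using this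
    exact tendsto_of_tendsto_of_tendsto_of_le_of_le tendsto_const_nhds h3 (fun _ => zero_le) hle

theorem ae_summable_of_integral_le {Ω : Type*} [MeasurableSpace Ω] {P : Measure Ω}
    {Z : ℕ → Ω → ℝ} {c : ℕ → ℝ} (hZ : ∀ n, Integrable (Z n) P) (hpos : ∀ n ω, 0 ≤ Z n ω)
    (hle : ∀ n, ∫ ω, Z n ω ∂P ≤ c n) (hc : Summable c) :
    ∀ᵐ ω ∂P, Summable fun n => Z n ω := by
  have hm : ∀ n, AEMeasurable (fun ω => ENNReal.ofReal (Z n ω)) P := fun n =>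
    (hZ n).aemeasurable.ennreal_ofReal
  have hfin : ∫⁻ ω, ∑' n, ENNReal.ofReal (Z n ω) ∂P ≠ ∞ := by
    rw [lintegral_tsum hm]
    refine ne_top_of_le_ne_top hc.tsum_ofReal_ne_top (ENNReal.tsum_le_tsum fun n => ?_)
    rw [← ofReal_integral_eq_lintegral_ofReal (hZ n) (ae_of_all _ (hpos n))]
    exact ENNReal.ofReal_le_ofReal (hle n)
  filter_upwards [ae_lt_top' (AEMeasurable.tsum hm) hfin] with ω hω
  have := ENNReal.summable_toReal hω.ne
  simpa only [ENNReal.toReal_ofReal (hpos _ ω)] using this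

/-- The level `n` energy has expectation at most `K 2^n p^(2n)`, so after division by `r^(2n)` the
expectations are dominated by a geometric series of ratio `2 (p / r)²`. -/
theorem ae_summable_dyadicEnergy {Ω : Type*} [MeasurableSpace Ω] {P : Measure Ω}
    {X : I → Ω → ℝ} {K p r : ℝ} (hX : ∀ t, MemLp (X t) 2 P) (hr : 0 < r)
    (hpr : 2 * (p / r) ^ 2 < 1)
    (hp : ∀ m : ℕ, ∀ u v : I, |(u : ℝ) - v| ≤ (1 / 2) ^ m →
      ∫ ω, (X u ω - X v ω) ^ 2 ∂P ≤ K * (p ^ m) ^ 2) :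
    ∀ᵐ ω ∂P, Summable fun n =>
      dyadicEnergy (fun t => X (Set.projIcc 0 1 zero_le_one t) ω) n 0 1 / (r ^ n) ^ 2 := by
  have hsq : ∀ u v, Integrable (fun ω => (X u ω - X v ω) ^ 2) P := fun u v =>
    ((hX u).sub (hX v)).integrable_sq
  have hen : ∀ n ω, dyadicEnergy (fun t => X (Set.projIcc 0 1 zero_le_one t) ω) n 0 1 =
      ∑ k ∈ Finset.range (2 ^ n), (X (dyadicPoint n (k + 1)) ω - X (dyadicPoint n k) ω) ^ 2 := by
    intro n ω
    refine Finset.sum_congr rfl fun k hk => ?_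
    have hk' : (k : ℝ) + 1 ≤ 2 ^ n := by exact_mod_cast Finset.mem_range.1 hk
    rw [if_pos ⟨by positivity, (div_le_one (by positivity)).2 hk'⟩]
    simp [dyadicPoint]
  simp only [hen]
  refine ae_summable_of_integral_le (c := fun n => K * (2 * (p / r) ^ 2) ^ n)
    (fun n => (integrable_finsetSum _ fun k _ => hsq _ _).div_const _)
    (fun n ω => by positivity) (fun n => ?_)
    ((summable_geometric_of_lt_one (by positivity) hpr).mul_left K)
  rw [integral_div, integral_finsetSum _ fun k _ => hsq _ _, div_le_iff₀ (by positivity)]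
  refine (Finset.sum_le_card_nsmul _ _ (K * (p ^ n) ^ 2) fun k hk => hp n _ _ ?_).trans_eq ?_
  · have hk' := Finset.mem_range.1 hk
    rw [coe_dyadicPoint hk', coe_dyadicPoint hk'.le, ← sub_div, one_div_pow]
    push_cast
    rw [add_sub_cancel_left, abs_of_pos (by positivity)]
  · simp only [Finset.card_range, nsmul_eq_mul, Nat.cast_pow, Nat.cast_ofNat, mul_pow, div_pow]
    field_simp
    ring

theorem HasYoungIntegral.tendsto_dyadicSum {g x : I → ℝ} {y : ℝ} (h : HasYoungIntegral g x y) :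
    Tendsto (dyadicSum g x) atTop (𝓝 y) := by
  rw [Metric.tendsto_atTop]
  intro ε hε
  obtain ⟨δ, hδ, H⟩ := h ε hε
  obtain ⟨M, hM⟩ := exists_pow_lt_of_lt_one hδ (by norm_num : (1 / 2 : ℝ) < 1)
  refine ⟨M, fun N hN => ?_⟩
  rw [Real.dist_eq]
  refine H (2 ^ N) (dyadicPoint N) (dyadicPoint N) (dyadicPoint_zero N) (dyadicPoint_two_pow N)
    fun i hi => ⟨le_rfl, (dyadicPoint_lt (Nat.lt_succ_self i) hi).le, lt_of_le_of_lt ?_ hM⟩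
  rw [coe_dyadicPoint hi, coe_dyadicPoint hi.le, ← sub_div]
  push_cast
  rw [add_sub_cancel_left, ← one_div_pow]
  exact pow_le_pow_of_le_one (by norm_num) (by norm_num) hN

section Chaos

variable {Ω H ι : Type*} [MeasurableSpace Ω] [NormedAddCommGroup H] [InnerProductSpace ℝ H]
  {P : Measure Ω} {e : HilbertBasis ι ℝ H} {W : H → Ω → ℝ}

theorem IsMultipleIntegral.sub (hW : IsIsonormal W P) {n : ℕ} {u v : HilbertTensorPower ι n}
    {Y Z : Ω → ℝ} (hu : IsMultipleIntegral e W P u Y) (hv : IsMultipleIntegral e W P v Z) :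
    IsMultipleIntegral e W P (u - v) (fun ω => Y ω - Z ω) := by
  have := IsMultipleIntegral.sum Finset.univ hW (u := fun b : Bool => cond b u v)
    (Y := fun b => cond b Y Z) (e := e) (by simp [hu, hv]) fun b => cond b 1 (-1)
  simpa [sub_eq_add_neg] using this

theorem IsMultipleIntegral.dyadicSum (hW : IsIsonormal W P) {n : ℕ}
    {f : I → HilbertTensorPower ι n} {X : I → Ω → ℝ}
    (hX : ∀ t, IsMultipleIntegral e W P (f t) (X t)) (g : I → ℝ) (N : ℕ) :
    IsMultipleIntegral e W P (dyadicSum g f N) (fun ω => dyadicSum g (fun t => X t ω) N) :=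
  IsMultipleIntegral.sum _ hW (fun _ _ => (hX _).sub hW (hX _)) _

/-- The Young integral of a Hölder function against a process in a fixed Wiener chaos: existence,
square integrability and the isometry property. -/
theorem exists_youngIntegral_of_isMultipleIntegral (hW : IsIsonormal W P) {n : ℕ}
    {f : I → HilbertTensorPower ι n} {X : I → Ω → ℝ}
    (hX : ∀ t, IsMultipleIntegral e W P (f t) (X t))
    (hcont : ∀ᵐ ω ∂P, Continuous fun t => X t ω) {g : I → ℝ} {p q r C L : ℝ}
    (hr : 0 < r) (hr1 : r < 1) (hq : 0 < q) (hqr : √2 * (q * r) < 1) (hpq : 2 * (p * q) < 1)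
    (hpr : 2 * (p / r) ^ 2 < 1) (hL : 0 ≤ L)
    (hg : ∀ m : ℕ, ∀ u v : I, |(u : ℝ) - v| ≤ 2 * (1 / 2) ^ m → |g u - g v| ≤ L * q ^ m)
    (hf : ∀ m : ℕ, ∀ u v : I, |(u : ℝ) - v| ≤ (1 / 2) ^ m → ‖f u - f v‖ ≤ C * p ^ m) :
    ∃ (Y : Ω → ℝ) (v : HilbertTensorPower ι n), MemLp Y 2 P ∧
      (∀ᵐ ω ∂P, HasYoungIntegral g (fun t => X t ω) (Y ω)) ∧
      Tendsto (_root_.dyadicSum g f) atTop (𝓝 v) ∧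
      ∫ ω, Y ω ^ 2 ∂P = n.factorial * ‖v‖ ^ 2 := by
  classical
  have hsub : ∀ u v : I, ∫ ω, (X u ω - X v ω) ^ 2 ∂P = n.factorial * ‖f u - f v‖ ^ 2 :=
    fun u v => ((hX u).sub hW (hX v)).integral_sq hW
  have hsum := ae_summable_dyadicEnergy (X := X) (P := P) (K := n.factorial * C ^ 2)
    (fun t => (hX t).memLp) hr hpr fun m u v huv => by
      rw [hsub, mul_assoc, ← mul_pow]
      gcongr
      exact hf m u v huv
  have hyoung : ∀ᵐ ω ∂P, ∃ y, HasYoungIntegral g (fun t => X t ω) y := by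
    filter_upwards [hsum, hcont] with ω h1 h2
    have := exists_hasYoungIntegral (g := fun t => g (Set.projIcc 0 1 zero_le_one t))
      (h2.comp (continuous_projIcc (h := zero_le_one))) h1 hr hr1 hq hqr hL fun m u v huv =>
        hg m _ _ ((Set.abs_projIcc_sub_projIcc zero_le_one).trans huv)
    simpa [Function.comp_def] using this
  -- Pointwise choice gives no measurability; it is recovered below from the convergence of the
  -- dyadic sums.
  let Y : Ω → ℝ := fun ω => if h : ∃ y, HasYoungIntegral g (fun t => X t ω) y then h.choose else 0
  have hY : ∀ᵐ ω ∂P, HasYoungIntegral g (fun t => X t ω) (Y ω) := by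
    filter_upwards [hyoung] with ω hω
    simp only [Y, dif_pos hω]
    exact hω.choose_spec
  obtain ⟨v, hv⟩ := exists_tendsto_dyadicSum hq hpq hL
    (fun m u v huv => hg m u v (huv.trans (le_mul_of_one_le_left (by positivity) one_le_two))) hf
  have hI := fun N => IsMultipleIntegral.dyadicSum (e := e) hW hX g N
  obtain ⟨hY2, hlim⟩ := memLp_and_tendsto_of_isometry (fun N => (hI N).memLp)
    (hY.mono fun ω hω => hω.tendsto_dyadicSum)
    (fun M N => ((hI N).sub hW (hI M)).integral_sq hW) hv
  refine ⟨Y, v, hY2, hY, hv, ?_⟩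
  have h1 := tendsto_integral_sq (fun N => (hI N).memLp) hY2 hlim
  simp only [fun N => (hI N).integral_sq hW] at h1
  exact tendsto_nhds_unique h1 ((hv.norm.pow 2).const_mul _)

end Chaos

/-! ### Intervals on which a Hölder function is large -/

theorem MemHolder.abs_sub_le {τ : ℝ≥0} {g : I → ℝ} (hg : MemHolder τ g) (u v : I) :
    |g u - g v| ≤ nnHolderNorm τ g * |(u : ℝ) - v| ^ (τ : ℝ) := by
  have := hg.holderWith.dist_le u v
  rwa [Real.dist_eq, Subtype.dist_eq, Real.dist_eq] at this

/-- Near its maximum a Hölder function keeps its sign and at least half of its maximal size: on the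
whole unit interval, or on an interval whose length is given by the Hölder norm. -/
theorem MemHolder.exists_interval {τ : ℝ≥0} (hτ : 0 < τ) {g : I → ℝ} (hg : MemHolder τ g)
    {M : ℝ} (hM : 0 < M) {u : I} (hu : |g u| = M) :
    ∃ s t : I, s < t ∧
      ((∀ v, s ≤ v → v ≤ t → M / 2 ≤ g v) ∨ ∀ v, s ≤ v → v ≤ t → M / 2 ≤ -g v) ∧
      ((s = 0 ∧ t = 1) ∨
        M / 2 = nnHolderNorm τ g * ((t : ℝ) - s) ^ (τ : ℝ)) := by
  set G : ℝ := (nnHolderNorm τ g : ℝ)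
  have hτ' : (0 : ℝ) < τ := hτ
  have hG0 : 0 ≤ G := NNReal.coe_nonneg _
  have hlarge : ∀ s t : I, (∀ v, s ≤ v → v ≤ t → G * |(v : ℝ) - u| ^ (τ : ℝ) ≤ M / 2) →
      (∀ v, s ≤ v → v ≤ t → M / 2 ≤ g v) ∨ ∀ v, s ≤ v → v ≤ t → M / 2 ≤ -g v := by
    intro s t h
    rcases abs_choice (g u) with h1 | h1
    · left
      intro v hv1 hv2
      have h2 := (hg.abs_sub_le v u).trans (h v hv1 hv2)
      rw [abs_le] at h2
      linarith [h2.1]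
    · right
      intro v hv1 hv2
      have h2 := (hg.abs_sub_le v u).trans (h v hv1 hv2)
      rw [abs_le] at h2
      linarith [h2.2]
  rcases hG0.eq_or_lt with h0 | h0
  · refine ⟨0, 1, by simp, hlarge 0 1 fun v _ _ => ?_, Or.inl ⟨rfl, rfl⟩⟩
    rw [← h0]
    linarith
  -- `δ` solves `G δ^τ = M / 2`: within distance `δ` of `u` the function loses at most half of its
  -- size.
  set δ : ℝ := (M / 2 / G) ^ ((τ : ℝ)⁻¹) with hδ
  have hδ0 : 0 < δ := by positivity
  have hδτ : G * δ ^ (τ : ℝ) = M / 2 := by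
    rw [hδ, Real.rpow_inv_rpow (by positivity) hτ'.ne']
    field_simp
  have hnear : ∀ v : I, |(v : ℝ) - u| ≤ δ → G * |(v : ℝ) - u| ^ (τ : ℝ) ≤ M / 2 := by
    intro v hv
    rw [← hδτ]
    gcongr
  by_cases h1 : (u : ℝ) + δ ≤ 1
  · refine ⟨u, ⟨u + δ, by linarith [u.2.1], h1⟩, ?_, hlarge _ _ fun v hv1 hv2 => hnear v ?_,
      Or.inr ?_⟩
    · rw [← Subtype.coe_lt_coe]
      simpa using hδ0
    · rw [← Subtype.coe_le_coe] at hv1 hv2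
      simp only at hv2
      rw [abs_le]
      constructor <;> linarith
    · simp [hδτ]
  by_cases h2 : δ ≤ u
  · refine ⟨⟨u - δ, by linarith, by linarith [u.2.2]⟩, u, ?_, hlarge _ _ fun v hv1 hv2 => hnear v ?_,
      Or.inr ?_⟩
    · rw [← Subtype.coe_lt_coe]
      simpa using hδ0
    · rw [← Subtype.coe_le_coe] at hv1 hv2
      simp only at hv1
      rw [abs_le]
      constructor <;> linarith
    · simp [hδτ]
  -- Neither side of `u` has room for length `δ`, so all of `[0, 1]` lies within `δ` of `u`.
  · refine ⟨0, 1, by simp, hlarge 0 1 fun v _ _ => hnear v ?_, Or.inl ⟨rfl, rfl⟩⟩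
    have := v.2.1
    have := v.2.2
    rw [abs_le]
    constructor <;> linarith

/-! ### From the second-moment bound to the bound on the maximum -/

theorem le_of_sq_mul_le {β M A B : ℝ} (hβ : 0 < β) (hM : 0 < M) (hA : 0 < A)
    (h : β * (M / 2) ^ 2 * A ≤ B) :
    M ≤ 2 / √β * A ^ (-(1 / 2) : ℝ) * B ^ (1 / 2 : ℝ) := by
  have h1 : √β * (M / 2) * √A ≤ √B := by
    refine Real.le_sqrt_of_sq_le ?_
    rw [mul_pow, mul_pow, Real.sq_sqrt hβ.le, Real.sq_sqrt hA.le]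
    exact h
  rw [Real.rpow_neg hA.le, ← Real.sqrt_eq_rpow, ← Real.sqrt_eq_rpow]
  have h2 : 0 < √β := Real.sqrt_pos.2 hβ
  have h3 : 0 < √A := Real.sqrt_pos.2 hA
  calc M = 2 / √β * (√A)⁻¹ * (√β * (M / 2) * √A) := by field_simp
    _ ≤ _ := by gcongr

/-- Raise `h` to the power `τ / (2τ + η)` and multiply by `G^(η / (2τ + η))`. Then `δ` enters only
through `G δ^τ = M / 2`, and the powers of `M / 2` add up to `1`. -/
theorem le_of_rpow_mul_le {D M B G δ τ η : ℝ} (hD : 0 < D) (hM : 0 < M) (hδ : 0 < δ)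
    (hG : 0 ≤ G) (hτ : 0 < τ) (hη : 0 < η) (h : D * (M / 2) ^ 2 * δ ^ η ≤ B)
    (hδM : M / 2 = G * δ ^ τ) :
    M ≤ 2 / D ^ (τ / (2 * τ + η)) * B ^ (τ / (2 * τ + η)) * G ^ (η / (2 * τ + η)) := by
  set m := M / 2 with hm
  have hm0 : 0 < m := by positivity
  have hs : 0 < 2 * τ + η := by positivity
  have h1 : (D * m ^ 2 * δ ^ η) ^ (τ / (2 * τ + η)) ≤ B ^ (τ / (2 * τ + η)) := by gcongr
  have h2 : (D * m ^ 2 * δ ^ η) ^ (τ / (2 * τ + η)) * G ^ (η / (2 * τ + η)) =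
      D ^ (τ / (2 * τ + η)) * m := by
    rw [Real.mul_rpow (by positivity) (by positivity), Real.mul_rpow (by positivity) (by positivity),
      ← Real.rpow_mul hδ.le, ← Real.rpow_natCast m 2, ← Real.rpow_mul hm0.le,
      show η * (τ / (2 * τ + η)) = τ * (η / (2 * τ + η)) by ring, Real.rpow_mul hδ.le, mul_assoc,
      ← Real.mul_rpow (by positivity) hG, mul_comm (δ ^ τ) G, ← hδM, mul_assoc,
      ← Real.rpow_add hm0]
    have : ((2 : ℕ) : ℝ) * (τ / (2 * τ + η)) + η / (2 * τ + η) = 1 := by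
      push_cast
      field_simp
    rw [this, Real.rpow_one]
  have hDp : 0 < D ^ (τ / (2 * τ + η)) := by positivity
  calc M = 2 / D ^ (τ / (2 * τ + η)) * (D ^ (τ / (2 * τ + η)) * m) := by
        rw [hm]; field_simp
    _ = 2 / D ^ (τ / (2 * τ + η)) *
        ((D * m ^ 2 * δ ^ η) ^ (τ / (2 * τ + η)) * G ^ (η / (2 * τ + η))) := by rw [h2]
    _ ≤ 2 / D ^ (τ / (2 * τ + η)) * (B ^ (τ / (2 * τ + η)) * G ^ (η / (2 * τ + η))) := by gcongr
    _ = _ := by ring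

theorem KernelRegularity.norm_sub_le {E : Type*} [NormedAddCommGroup E] {f : I → E} {θ : ℝ}
    (h : KernelRegularity f θ) :
    ∃ C : ℝ, 0 < C ∧ ∀ u v : I, ‖f u - f v‖ ≤ C * |(u : ℝ) - v| ^ (θ / 2) := by
  obtain ⟨C, hC, hb⟩ := h.holder
  have hlt : ∀ u v : I, u < v → ‖f u - f v‖ ≤ C * |(u : ℝ) - v| ^ (θ / 2) := by
    intro u v huv
    have : (u : ℝ) < v := huv
    rw [norm_sub_rev, abs_sub_comm, abs_of_pos (by linarith)]
    exact (hb u v huv).2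
  refine ⟨C, hC, fun u v => ?_⟩
  rcases lt_trichotomy u v with huv | rfl | huv
  · exact hlt u v huv
  · rw [sub_self, norm_zero]
    positivity
  · rw [norm_sub_rev, abs_sub_comm]
    exact hlt v u huv

theorem half_pow_rpow (m : ℕ) (a : ℝ) : ((1 / 2 : ℝ) ^ m) ^ a = ((2 : ℝ) ^ (-a)) ^ m := by
  rw [← Real.rpow_natCast, ← Real.rpow_mul (by norm_num), mul_comm, Real.rpow_mul (by norm_num),
    Real.rpow_natCast, one_div, Real.inv_rpow (by norm_num), Real.rpow_neg (by norm_num)]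

/-! ### The main theorem -/

theorem mainTheorem8 {Ω : Type*} [MeasurableSpace Ω] (P : Measure Ω) [IsProbabilityMeasure P]
    {H : Type*} [NormedAddCommGroup H] [InnerProductSpace ℝ H] [CompleteSpace H]
    [TopologicalSpace.SeparableSpace H]
    {ι : Type*} (e : HilbertBasis ι ℝ H)
    (W : H → Ω → ℝ) (hW : IsIsonormal W P)
    (n : ℕ) (hn : 1 ≤ n)
    (f : I → HilbertTensorPower ι n)
    (X : I → Ω → ℝ) (hX : ∀ t, IsMultipleIntegral e W P (f t) (X t))
    (hcont : ∀ᵐ ω ∂P, Continuous fun t => X t ω)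
    (θ : ℝ) (hreg : KernelRegularity f θ)
    (β : ℝ) (hker : KernelNondeterminism f β)
    (hrow : NonnegRowSum f)
    (τ : ℝ≥0) (hτ : 0 < τ) (ρ : ℝ) (hρ : ρ < θ / 2) (hτρ : 1 < (τ : ℝ) + ρ)
    (g : I → ℝ) (hg : MemHolder τ g)
    (η C : ℝ) (hη : 0 < η) (hC : 0 < C)
    (hlow : ∀ s t : I, s < t →
      C * ((t : ℝ) - s) ^ η ≤ ∫ ω, (X t ω - X s ω) ^ 2 ∂P) :
    ∃ Y : Ω → ℝ, MemLp Y 2 P ∧ (∀ᵐ ω ∂P, HasYoungIntegral g (fun t => X t ω) (Y ω)) ∧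
      (⨆ r : I, |g r|) ≤
        max
          (2 / √β * (∫ ω, X 1 ω ^ 2 ∂P) ^ (-(1 / 2) : ℝ) * (∫ ω, Y ω ^ 2 ∂P) ^ (1 / 2 : ℝ))
          (2 / (β * C) ^ ((τ : ℝ) / (2 * τ + η)) *
            (∫ ω, Y ω ^ 2 ∂P) ^ ((τ : ℝ) / (2 * τ + η)) *
            (nnHolderNorm τ g : ℝ) ^ (η / (2 * τ + η))) := by
  have hτ' : (0 : ℝ) < τ := hτ
  have hθ : 0 < θ / 2 := by linarith [hreg.one_lt]
  obtain ⟨C₀, hC₀, hf⟩ := hreg.norm_sub_le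
  have hfc : Continuous f := by
    refine continuous_iff_continuousAt.2 fun v => tendsto_iff_norm_sub_tendsto_zero.2 ?_
    have h : Continuous fun u : I => C₀ * |(u : ℝ) - v| ^ (θ / 2) :=
      continuous_const.mul
        ((continuous_subtype_val.sub continuous_const).abs.rpow_const fun _ => Or.inr hθ.le)
    refine squeeze_zero (fun _ => norm_nonneg _) (fun u => hf u v) ?_
    have h0 := h.tendsto v
    rwa [sub_self, abs_zero, Real.zero_rpow hθ.ne', mul_zero] at h0
  have hgc : Continuous g := hg.holderWith.continuous hτ
  -- `ρ' > ρ` gives `τ + ρ' > 1`, `ρ' > 1/2` gives `r < 1`, and `ρ' < θ/2` makes the weighted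
  -- energies summable.
  obtain ⟨ρ', hρ₁, hρ₂⟩ := exists_between (max_lt hρ (by linarith [hreg.one_lt] : 1 / 2 < θ / 2))
  rw [max_lt_iff] at hρ₁
  have hsqrt : √2 = (2 : ℝ) ^ (1 / 2 : ℝ) := Real.sqrt_eq_rpow 2
  have hlt1 : ∀ a : ℝ, a < 0 → (2 : ℝ) ^ a < 1 := fun a ha =>
    Real.rpow_lt_one_of_one_lt_of_neg one_lt_two ha
  -- `p`, `q`, `r` are decay rates per dyadic level. The three product conditions say that `1 - τ -
  -- ρ'`, `1 - θ/2 - τ` and `2ρ' - θ` are negative. The factor `2^τ` in `L` absorbs the distance `2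
  -- * 2^-m`.
  obtain ⟨Y, v, hY2, hY, hv, hYv⟩ := exists_youngIntegral_of_isMultipleIntegral hW hX hcont
    (g := g) (p := 2 ^ (-(θ / 2))) (q := 2 ^ (-(τ : ℝ))) (r := 2 ^ (-(ρ' - 1 / 2))) (C := C₀)
    (L := (nnHolderNorm τ g : ℝ) * 2 ^ (τ : ℝ)) (by positivity) (hlt1 _ (by linarith)) (by positivity)
    (by
      rw [hsqrt, ← Real.rpow_add two_pos, ← Real.rpow_add two_pos]
      exact hlt1 _ (by linarith))
    (by
      rw [← Real.rpow_add two_pos]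
      nth_rewrite 1 [← Real.rpow_one 2]
      rw [← Real.rpow_add two_pos]
      exact hlt1 _ (by linarith))
    (by
      rw [← Real.rpow_sub two_pos, ← Real.rpow_natCast, ← Real.rpow_mul two_pos.le]
      nth_rewrite 1 [← Real.rpow_one 2]
      rw [← Real.rpow_add two_pos]
      refine hlt1 _ ?_
      push_cast
      linarith)
    (by positivity)
    (fun m u v huv => by
      refine (hg.abs_sub_le u v).trans ?_
      rw [← half_pow_rpow, mul_assoc, ← Real.mul_rpow (by norm_num) (by positivity)]
      gcongr)
    (fun m u v huv => by
      refine (hf u v).trans ?_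
      rw [← half_pow_rpow]
      gcongr)
  refine ⟨Y, hY2, hY, ?_⟩
  obtain ⟨u, -, hu⟩ := isCompact_univ.exists_isMaxOn Set.univ_nonempty
    (hgc.abs.continuousOn (s := Set.univ))
  refine (ciSup_le fun w => hu (Set.mem_univ w)).trans ?_
  change |g u| ≤ _
  have hB : 0 ≤ ∫ ω, Y ω ^ 2 ∂P := integral_nonneg fun ω => sq_nonneg _
  rcases (abs_nonneg (g u)).eq_or_lt with h0 | hpos
  · rw [← h0]
    refine le_max_of_le_right ?_
    have := hker.pos
    positivity
  obtain ⟨s, t, hst, hlarge, hcase⟩ := hg.exists_interval hτ hpos rfl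
  have hsub : ∀ u v : I, ∫ ω, (X u ω - X v ω) ^ 2 ∂P = n.factorial * ‖f u - f v‖ ^ 2 :=
    fun u v => ((hX u).sub hW (hX v)).integral_sq hW
  have hkey : β * (|g u| / 2) ^ 2 * ∫ ω, (X t ω - X s ω) ^ 2 ∂P ≤ ∫ ω, Y ω ^ 2 ∂P := by
    have := hker.norm_limit_sq_ge hrow hfc (half_pos hpos) hst hlarge hv
    rw [hYv, hsub]
    calc β * (|g u| / 2) ^ 2 * (n.factorial * ‖f t - f s‖ ^ 2)
        = n.factorial * (β * (|g u| / 2 * ‖f t - f s‖) ^ 2) := by ring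
      _ ≤ _ := by gcongr
  have hpos' : 0 < (t : ℝ) - s := sub_pos.2 hst
  have hβ := hker.pos
  rcases hcase with ⟨rfl, rfl⟩ | hlen
  · refine le_max_of_le_left ?_
    -- `X 0` need not vanish at every `ω`, so the second moments are compared through the kernels
    -- and `f 0 = 0`.
    have h1 : ∫ ω, X 1 ω ^ 2 ∂P = ∫ ω, (X 1 ω - X 0 ω) ^ 2 ∂P := by
      rw [hsub, hreg.zero, sub_zero, (hX 1).integral_sq hW]
    rw [h1]
    refine le_of_sq_mul_le hβ hpos (lt_of_lt_of_le ?_ (hlow 0 1 hst)) hkey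
    positivity
  · refine le_max_of_le_right ?_
    refine le_of_rpow_mul_le (mul_pos hβ hC) hpos hpos' (NNReal.coe_nonneg _) hτ' hη
      (le_trans ?_ hkey) hlen
    calc β * C * (|g u| / 2) ^ 2 * ((t : ℝ) - s) ^ η
        = β * (|g u| / 2) ^ 2 * (C * ((t : ℝ) - s) ^ η) := by ring
      _ ≤ _ := by
        gcongr
        exact hlow s t hst
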